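/- **Setting.** Let $\mathcal M=(S,A,P,s_0,AP,L)$ be a finite Markov decision process: $S$ and $A$ are finite, $A(s)\subseteq A$ is the set of actions available at $s$, $P(s,a,q)\in[0,1]$ with $\sum_{q}P(s,a,q)=1$ for $a\in A(s)$, $AP$ is a finite set of atomic propositions, and $L:S\to 2^{AP}$. Let $\varphi^{\mathcal S},\varphi^{\mathcal A}$ be co-safe LTL formulae over $AP$ (every satisfying word has a finite good prefix), represented by deterministic finite automata $\mathcal D_{\mathcal S},\mathcal D_{\mathcal A}$ over the alphabet $2^{AP}$: an infinite word satisfies the formula iff the run on it visits an accepting state, and a finite word that is accepted stays accepted under every extension (as for the automaton accepting the good prefixes). Let $\mathcal M_p$ be the product of $\mathcal M$ with the product automaton of $\mathcal D_{\mathcal S}$ and $\mathcal D_{\mathcal A}$: its states are the triples $(s,q^{\mathcal S},q^{\mathcal A})$, its initial state consists of $s_0$ and the automaton states after reading $L(s_0)$, and a move to $s'$ happens with probability $P(s,a,s')$ while both automata read $L(s')$. Write $S_p,s_{0_p},P_{s,a,q},A(s),Succ(s)$ for the states, initial state, transition probabilities, available actions and successor sets ($q\in Succ(s)$ iff $P_{s,a,q}>0$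 for some $a\in A(s)$) of $\mathcal M_p$, and let $C_{\mathcal A}$ be the set of product states with $q^{\mathcal A}$ accepting. A policy of $\mathcal M_p$ is a sequence $\pi=\mu_0\mu_1\dots$ of maps $\mu_t:S_p\times A\to[0,1]$ with $\sum_{a\in A(s)}\mu_t(s,a)=1$ for all $s$; it is stationary if $\mu_t$ does not depend on $t$. Let $\Gamma^\pi$ be the law under $\pi$ of the infinite path of states from $s_{0_p}$, and $x^\pi_{s,a}=\sum_{t\ge0}\Pr^\pi(s_t=s)\,\mu_t(s,a)$ the expected residence times. Fix a stationary reference policy $\pi^{\mathcal S}$ of $\mathcal M_p$ and a threshold $\nu\in[0,1]$. Put $\pi^{\mathcal S}_{s,q}=\sum_{a\in A(s)}P_{s,a,q}\pi^{\mathcal S}_{s,a}$, let $C_{cl}$ be the set of states belonging to a closed communicating class of the Markov chain with these transition probabilities, and let $S_d=S_p\setminus(C_{cl}\cup C_{\mathcal A})$. **Deceptive policy problem.** Minimize $KL(\Gamma^{\pi}\,\|\,\Gamma^{\pi^{\mathcal S}})$ over all policies $\pi$ of $\mathcal M_p$ (stationary or not) such that $\Pr^{\pi}(\exists k:\ s_k\in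 C_{\mathcal A})\ge\nu$. **Residence-time program.** Over real variables $x_{s,a}$ ($s\in S_d$, $a\in A(s)$), minimize $$\sum_{s\in S_d}\sum_{a\in A(s)}\sum_{q\in Succ(s)}x_{s,a}P_{s,a,q}\log\left(\frac{\sum_{a'\in A(s)}x_{s,a'}P_{s,a',q}}{\pi^{\mathcal S}_{s,q}\sum_{a'\in A(s)}x_{s,a'}}\right)$$ (a term is $0$ if $x_{s,a}P_{s,a,q}=0$, and otherwise $\infty$ if the denominator vanishes) subject to $$x_{s,a}\ge0\quad(s\in S_d,\ a\in A(s)),$$ $$\sum_{a\in A(s)}x_{s,a}-\sum_{q\in S_d}\sum_{a\in A(q)}x_{q,a}P_{q,a,s}=\mathbb 1_{s_{0_p}}(s)\quad(s\in S_d),$$ $$\sum_{q\in C_{\mathcal A}}\Big(\sum_{s\in S_d}\sum_{a\in A(s)}x_{s,a}P_{s,a,q}+\mathbb 1_{s_{0_p}}(q)\Big)\ge\nu.$$ **Proposition.** The residence-time program is a convex optimization problem: its objective is a convex function, with values in $(-\infty,\infty]$, on the nonnegative orthant, its inequality constraint functions are convex, and its equality constraint functions are affine. Its optimal value equals the optimal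 value of the deceptive policy problem (both being $\infty$ if there is no feasible point). If this common value is finite, then there is a stationary policy $\pi$ of $\mathcal M_p$ that attains it: the expected residence times $x^\pi_{s,a}$, $s\in S_d$, $a\in A(s)$, are finite, they are feasible for the residence-time program and their objective is its optimal value; and $\pi$ itself is feasible and optimal in the deceptive policy problem. -/

import Mathlib

open MeasureTheory ProbabilityTheory InformationTheory
open scoped ENNReal

/-! ### Linear temporal logic and automata -/

/-- Formulae of linear temporal logic over a set `AP` of atomic propositions. -/
inductive LTL (AP : Type*) where
  | atom (p : AP)
  | neg (φ : LTL AP)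
  | and (φ ψ : LTL AP)
  | or (φ ψ : LTL AP)
  | imp (φ ψ : LTL AP)
  | always (φ : LTL AP)
  | eventually (φ : LTL AP)
  | next (φ : LTL AP)
  | untl (φ ψ : LTL AP)

namespace LTL

variable {AP : Type*}

/-- `φ.SatFrom w i`: the infinite word `w` satisfies `φ` from position `i` on. -/
def SatFrom (w : ℕ → Set AP) : LTL AP → ℕ → Prop
  | atom p, i => p ∈ w i
  | neg φ, i => ¬ SatFrom w φ i
  | and φ ψ, i => SatFrom w φ i ∧ SatFrom w ψ i
  | or φ ψ, i => SatFrom w φ i ∨ SatFrom w ψ i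
  | imp φ ψ, i => SatFrom w φ i → SatFrom w ψ i
  | always φ, i => ∀ j, i ≤ j → SatFrom w φ j
  | eventually φ, i => ∃ j, i ≤ j ∧ SatFrom w φ j
  | next φ, i => SatFrom w φ (i + 1)
  | untl φ ψ, i => ∃ j, i ≤ j ∧ SatFrom w ψ j ∧ ∀ k, i ≤ k → k < j → SatFrom w φ k

/-- The infinite word `w` satisfies `φ`. -/
def Sat (w : ℕ → Set AP) (φ : LTL AP) : Prop := SatFrom w φ 0

/-- The prefix of length `n` of an infinite word. -/
def wordPrefix (w : ℕ → Set AP) (n : ℕ) : List (Set AP) := (List.range n).map w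

/-- A finite word is a good prefix of `φ` if all its infinite extensions satisfy `φ`. -/
def IsGoodPrefix (φ : LTL AP) (u : List (Set AP)) : Prop :=
  ∀ w : ℕ → Set AP, wordPrefix w u.length = u → Sat w φ

/-- `φ` is co-safe: every infinite word that satisfies `φ` has a finite good prefix. -/
def IsCoSafe (φ : LTL AP) : Prop :=
  ∀ w : ℕ → Set AP, Sat w φ → ∃ n, IsGoodPrefix φ (wordPrefix w n)

/-- The automaton `D` represents `φ`: an infinite word satisfies `φ` iff the run of `D` on it
visits an accepting state, and a run that has accepted stays accepting (the specification, once
satisfied, remains satisfied). The automaton that accepts exactly the good prefixes of a co-safe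
formula is the standard example. -/
def IsRepresentedBy {Q : Type*} (φ : LTL AP) (D : DFA (Set AP) Q) : Prop :=
  (∀ w : ℕ → Set AP, Sat w φ ↔ ∃ n, wordPrefix w n ∈ D.accepts) ∧
    ∀ u v : List (Set AP), u ∈ D.accepts → u ++ v ∈ D.accepts

end LTL

/-- The product of the automata of the supervisor and the agent. -/
def productDFA {α Q₁ Q₂ : Type*} (D₁ : DFA α Q₁) (D₂ : DFA α Q₂) : DFA α (Q₁ × Q₂) where
  step q a := (D₁.step q.1 a, D₂.step q.2 a)
  start := (D₁.start, D₂.start)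
  accept := D₁.accept ×ˢ D₂.accept

/-! ### Markov decision processes -/

/-- A finite Markov decision process; `avail s` is the set of actions available at `s`. -/
structure MDP (S A AP : Type*) [Fintype S] where
  avail : S → Finset A
  prob : S → A → S → ℝ
  prob_nonneg : ∀ s a q, 0 ≤ prob s a q
  prob_le_one : ∀ s a q, prob s a q ≤ 1
  prob_sum : ∀ s, ∀ a ∈ avail s, ∑ q, prob s a q = 1
  init : S
  label : S → Set AP

namespace MDP

variable {S A AP : Type*} [Fintype S]

open scoped Classical in
/-- The product of an MDP with a deterministic finite automaton. -/
noncomputable def product {Q : Type*} [Fintype Q] (M : MDP S A AP) (D : DFA (Set AP) Q) :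
    MDP (S × Q) A Q where
  avail p := M.avail p.1
  prob p a p' := if p'.2 = D.step p.2 (M.label p'.1) then M.prob p.1 a p'.1 else 0
  prob_nonneg p a p' := by
    split_ifs
    · exact M.prob_nonneg _ _ _
    · exact le_rfl
  prob_le_one p a p' := by
    split_ifs
    · exact M.prob_le_one _ _ _
    · exact zero_le_one
  prob_sum p a ha := by
    rw [Fintype.sum_prod_type]
    simpa using M.prob_sum p.1 a ha
  init := (M.init, D.step D.start (M.label M.init))
  label p := {p.2}

variable (M : MDP S A AP)

/-- The successor states of `s`. -/
def Succ (s : S) : Set S := {q | ∃ a ∈ M.avail s, 0 < M.prob s a q}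

/-- A stationary policy (equivalently, the decision rule of a policy at one time step). -/
structure StationaryPolicy where
  act : S → A → ℝ
  act_nonneg : ∀ s a, 0 ≤ act s a
  act_le_one : ∀ s a, act s a ≤ 1
  act_sum : ∀ s, ∑ a ∈ M.avail s, act s a = 1

/-- A policy: a sequence of decision rules, one for every time step. -/
def Policy := ℕ → M.StationaryPolicy

variable {M}

/-- A stationary policy, seen as the policy that uses the same decision rule at all times. -/
def StationaryPolicy.toPolicy (π : M.StationaryPolicy) : M.Policy := fun _ => π

/-- Transition probabilities of the Markov chain induced by a decision rule. -/
noncomputable def StationaryPolicy.trans (π : M.StationaryPolicy) (s q : S) : ℝ :=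
  ∑ a ∈ M.avail s, M.prob s a q * π.act s a

theorem StationaryPolicy.trans_nonneg (π : M.StationaryPolicy) (s q : S) : 0 ≤ π.trans s q :=
  Finset.sum_nonneg fun a _ => mul_nonneg (M.prob_nonneg s a q) (π.act_nonneg s a)

theorem StationaryPolicy.trans_sum (π : M.StationaryPolicy) (s : S) :
    ∑ q, π.trans s q = 1 := by
  unfold StationaryPolicy.trans
  rw [Finset.sum_comm, ← π.act_sum s]
  refine Finset.sum_congr rfl fun a ha => ?_
  rw [← Finset.sum_mul, M.prob_sum s a ha, one_mul]

/-- The distribution of the successor state of `s`. -/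
noncomputable def StationaryPolicy.next (π : M.StationaryPolicy) (s : S) : PMF S :=
  PMF.ofFintype (fun q => ENNReal.ofReal (π.trans s q)) (by
    rw [← ENNReal.ofReal_sum_of_nonneg fun q _ => π.trans_nonneg s q, π.trans_sum s,
      ENNReal.ofReal_one])

section Paths

variable [MeasurableSpace S] [MeasurableSingletonClass S]

/-- The kernel that gives the law of the state at time `n + 1` from the states up to time `n`. -/
noncomputable def Policy.kernel (π : M.Policy) (n : ℕ) :
    Kernel ((i : Finset.Iic n) → (fun _ : ℕ => S) i) S where
  toFun h := ((π n).next (h ⟨n, Finset.mem_Iic.2 le_rfl⟩)).toMeasure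
  measurable' :=
    (measurable_of_countable fun s : S => ((π n).next s).toMeasure).comp (measurable_pi_apply _)

instance (π : M.Policy) (n : ℕ) : IsMarkovKernel (π.kernel n) :=
  ⟨fun h => PMF.toMeasure.isProbabilityMeasure
    ((π n).next (h ⟨n, Finset.mem_Iic.2 le_rfl⟩))⟩

/-- The distribution on infinite paths `s₀ s₁ s₂ …` under a policy, started at the initial
state. -/
noncomputable def Policy.pathMeasure (π : M.Policy) : Measure (ℕ → S) :=
  Kernel.trajMeasure (X := fun _ : ℕ => S) (Measure.dirac M.init) π.kernel

/-- The probability of eventually visiting `C`. -/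
noncomputable def Policy.reachProb (π : M.Policy) (C : Set S) : ℝ :=
  π.pathMeasure.real {ξ | ∃ k, ξ k ∈ C}

/-- The expected state-action residence time at `(s, a)`. -/
noncomputable def Policy.residenceTime (π : M.Policy) (s : S) (a : A) : ℝ≥0∞ :=
  ∑' t : ℕ, π.pathMeasure {ξ | ξ t = s} * ENNReal.ofReal ((π t).act s a)

/-- The policies that reach `C` with probability at least `ν`. -/
def deceptiveFeasible (M : MDP S A AP) (C : Set S) (ν : ℝ) : Set M.Policy :=
  {π | ν ≤ π.reachProb C}

/-- The objective of the deceptive policy problem: the Kullback–Leibler divergence of the path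
distribution from that of the reference policy. -/
noncomputable def pathKL (π : M.Policy) (πS : M.StationaryPolicy) : ℝ≥0∞ :=
  klDiv π.pathMeasure πS.toPolicy.pathMeasure

/-- The optimal value of the deceptive policy problem: the infimum of the divergence over all
policies that reach `C` with probability at least `ν`. -/
noncomputable def deceptiveValue (πS : M.StationaryPolicy) (C : Set S) (ν : ℝ) : ℝ≥0∞ :=
  ⨅ π ∈ M.deceptiveFeasible C ν, pathKL π πS

end Paths

/-! ### Closed communicating classes of the chain induced by a stationary policy -/

/-- `q` is accessible from `s`. -/
def StationaryPolicy.Accessible (π : M.StationaryPolicy) (s q : S) : Prop :=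
  Relation.ReflTransGen (fun u v => 0 < π.trans u v) s q

/-- `C` is a communicating class that is closed. -/
def StationaryPolicy.IsClosedClass (π : M.StationaryPolicy) (C : Set S) : Prop :=
  (∀ s ∈ C, ∀ q ∈ C, π.Accessible s q ∧ π.Accessible q s) ∧
    ∀ s ∈ C, ∀ q ∉ C, ¬ π.Accessible s q

/-- The set of states that belong to some closed communicating class. -/
def StationaryPolicy.closedStates (π : M.StationaryPolicy) : Set S :=
  {s | ∃ C, π.IsClosedClass C ∧ s ∈ C}

open scoped Classical in
/-- The states where the agent may deviate: those neither in a closed communicating class of the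
reference chain nor in the target set `C`. -/
noncomputable def diffStates (πS : M.StationaryPolicy) (C : Set S) : Finset S :=
  {s | s ∉ πS.closedStates ∪ C}

end MDP

/-! ### Optimization problems -/

/-- The problem of minimizing `objective x` over `x ∈ domain` subject to `ineq i x ≤ 0` for all `i`
and `eqn j x = 0` for all `j`. The domain is the set on which the objective is meaningful. -/
structure OptProgram (E ι κ : Type*) where
  domain : Set E
  objective : E → EReal
  ineq : ι → E → ℝ
  eqn : κ → E → ℝ

namespace OptProgram

variable {E ι κ : Type*}

/-- The feasible set. -/
def feasible (P : OptProgram E ι κ) : Set E :=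
  {x | x ∈ P.domain ∧ (∀ i, P.ineq i x ≤ 0) ∧ ∀ j, P.eqn j x = 0}

/-- The optimal value (`⊤` if there is no feasible point). -/
noncomputable def value (P : OptProgram E ι κ) : EReal := ⨅ x ∈ P.feasible, P.objective x

/-- A convex optimization problem: the objective is a convex extended-valued function on a convex
domain (that is, its epigraph is convex), the inequality constraint functions are convex and the
equality constraint functions are affine. -/
def IsConvex [AddCommGroup E] [Module ℝ E] (P : OptProgram E ι κ) : Prop :=
  Convex ℝ P.domain ∧
  (∀ x ∈ P.domain, P.objective x ≠ ⊥) ∧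
  Convex ℝ {p : E × ℝ | p.1 ∈ P.domain ∧ P.objective p.1 ≤ (p.2 : EReal)} ∧
  (∀ i, ConvexOn ℝ P.domain (P.ineq i)) ∧
  ∀ j, ∃ g : E →ᵃ[ℝ] ℝ, ∀ x, P.eqn j x = g x

end OptProgram

/-! ### The residence-time program -/

namespace MDP

variable {S A AP : Type*} [Fintype S] {M : MDP S A AP}

/-- The term `c * log (p / b)` of a divergence, with the conventions that it is `0` if `c = 0` and
`∞` if `c ≠ 0` and `b = 0`. -/
noncomputable def logTerm (c p b : ℝ) : EReal :=
  if c = 0 then 0 else if b = 0 then ⊤ else ((c * Real.log (p / b) : ℝ) : EReal)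

/-- The decision variables `x s a` for `s` in the set of states where the agent may deviate and
`a` available at `s`. -/
abbrev ResidenceVar (πS : M.StationaryPolicy) (C : Set S) : Type _ :=
  (s : diffStates πS C) → M.avail s → ℝ

open scoped Classical in
/-- The residence-time program. The inequality constraints are `0 ≤ x s a` and the reachability
constraint; the equality constraints are the flow equations. -/
noncomputable def residenceProgram (πS : M.StationaryPolicy) (C : Set S) (ν : ℝ) :
    OptProgram (ResidenceVar πS C)
      ((Σ s : diffStates πS C, M.avail s) ⊕ Unit) (diffStates πS C) where
  domain := {x | ∀ s a, 0 ≤ x s a}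
  objective x := ∑ s : diffStates πS C, ∑ a : M.avail s, ∑ q with q ∈ M.Succ s,
    logTerm (x s a * M.prob s a q)
      (∑ a' : M.avail s, x s a' * M.prob s a' q)
      (πS.trans s q * ∑ a' : M.avail s, x s a')
  ineq
    | Sum.inl p => fun x => -x p.1 p.2
    | Sum.inr _ => fun x => ν - ∑ q with q ∈ C,
        ((∑ s : diffStates πS C, ∑ a : M.avail s, x s a * M.prob s a q) +
          if q = M.init then 1 else 0)
  eqn s x := (∑ a : M.avail s, x s a)
    - (∑ q : diffStates πS C, ∑ a : M.avail q, x q a * M.prob q a s)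
    - if (s : S) = M.init then 1 else 0

/-- The vector of expected residence times of a policy at the states where the agent may deviate
(meaningful when these times are finite). -/
noncomputable def residenceVector [MeasurableSpace S] [MeasurableSingletonClass S]
    (πS : M.StationaryPolicy) (C : Set S) (π : M.Policy) : ResidenceVar πS C :=
  fun s a => (π.residenceTime (s : S) (a : A)).toReal

end MDP

/-! The chain rule writes the divergence of two path laws as the sum over times `t` and states `s`
of `Pr(s_t = s)` times the divergence of the successor distributions at `s` (`pathKL_eq_tsum`). The
program's objective is the same cost with time summed out first (`sum_logTerm_eq`). Both are built
from `relEnt`, a supremum of linear functions of `(p, b)`, hence homogeneous, subadditive and lower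
semicontinuous. Subadditivity over time shows that the residence times of a policy cost at most its
path divergence (`residenceDiv_residenceVector_le`). Conversely, normalising a feasible `x` at each
state gives a stationary policy whose path divergence is at most the objective at `x`
(`pathKL_residencePolicy_le`).

Only the states of `diffStates` matter. A finite divergence forbids transitions that the reference
policy lacks, so closed classes are never left, and the target is absorbing on the reachable states.
From a reachable closed state outside the target, the target cannot be entered, since there would be
a way back. Hence `diffStates` is never re-entered, the target is newly entered only from it, and
elsewhere copying the reference policy costs nothing.

Finiteness and compactness come from a potential `v ≥ 0` for which the reference expectation of `exp
(v(next) + ε - v(s))` is at most `1` off the closed classes (`exists_potential`). By the variational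
formula, one step at such a state costs at least `ε` plus the expected increase of `v`. Telescoping
bounds the total residence time by `(cost + v(init)) / ε`, both for policies and for feasible `x`.
Sublevel sets of the program are therefore compact and a minimiser exists.

A feasible `x` need not be the residence vector of its policy: it may contain an additional
circulation inside `diffStates`. Such a circulation has no outflow, so removing it leaves the
reachability constraint intact (`le_reachProb_residencePolicy`). -/

/-! ### Relative entropy of two nonnegative numbers -/

/-- The relative entropy `p log (p / b) + b - p` of two nonnegative numbers, in its variational
form; it is `∞` if `p > 0 = b`. -/
noncomputable def relEnt (p b : ℝ) : ℝ≥0∞ :=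
  ⨆ t : ℝ, ENNReal.ofReal (p * t + (1 - Real.exp t) * b)

theorem le_relEnt (p b t : ℝ) : ENNReal.ofReal (p * t + (1 - Real.exp t) * b) ≤ relEnt p b :=
  le_iSup (fun t : ℝ => ENNReal.ofReal (p * t + (1 - Real.exp t) * b)) t

@[simp] theorem relEnt_zero_zero : relEnt 0 0 = 0 := by simp [relEnt]

@[simp] theorem relEnt_self {p : ℝ} (hp : 0 ≤ p) : relEnt p p = 0 := by
  refine le_antisymm (iSup_le fun t => ?_) zero_le
  rw [ENNReal.ofReal_of_nonpos]
  nlinarith [Real.add_one_le_exp t]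

theorem relEnt_zero_right {p : ℝ} (hp : 0 < p) : relEnt p 0 = ⊤ := by
  refine ENNReal.eq_top_of_forall_nnreal_le fun r => ?_
  -- With `b = 0` the expression is `p * t`, so this `t` gives exactly the prescribed bound `r`.
  refine le_trans ?_ (le_relEnt p 0 (r / p))
  rw [mul_zero, add_zero, mul_div_cancel₀ _ hp.ne', ENNReal.ofReal_coe_nnreal]

/-- The concave function of `t` is maximal at `t = log (p / b)`; for `p = 0` its supremum `b` is
only approached as `t → -∞`. -/
theorem relEnt_eq {p b : ℝ} (hp : 0 ≤ p) (hb : 0 ≤ b) (h : b = 0 → p = 0) :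
    relEnt p b = ENNReal.ofReal (p * Real.log (p / b) + b - p) := by
  rcases hb.eq_or_lt with rfl | hb
  · simp [h rfl]
  refine le_antisymm (iSup_le fun t => ENNReal.ofReal_le_ofReal ?_) ?_
  · rcases hp.eq_or_lt with rfl | hp
    · simp only [zero_mul, zero_add, sub_zero]
      nlinarith [Real.exp_pos t]
    · have h1 := Real.add_one_le_exp (t - Real.log (p / b))
      rw [Real.exp_sub, Real.exp_log (by positivity)] at h1
      have h2 : p * (Real.exp t / (p / b)) = Real.exp t * b := by field_simp
      nlinarith [mul_le_mul_of_nonneg_left h1 hp.le]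
  · rcases hp.eq_or_lt with rfl | hp
    · have h1 : Filter.Tendsto (fun t : ℝ => ENNReal.ofReal (0 * t + (1 - Real.exp t) * b))
          Filter.atBot (nhds (ENNReal.ofReal ((1 - 0) * b))) := by
        refine ENNReal.tendsto_ofReal ?_
        simp only [zero_mul, zero_add]
        exact (tendsto_const_nhds.sub Real.tendsto_exp_atBot).mul_const b
      simpa using le_of_tendsto' h1 fun t => le_relEnt 0 b t
    · refine le_trans (le_of_eq ?_) (le_relEnt p b (Real.log (p / b)))
      rw [Real.exp_log (by positivity)]
      congr 1
      field_simp
      ring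

theorem relEnt_mul {c : ℝ} (hc : 0 ≤ c) (p b : ℝ) :
    relEnt (c * p) (c * b) = ENNReal.ofReal c * relEnt p b := by
  unfold relEnt
  rw [ENNReal.mul_iSup]
  refine iSup_congr fun t => ?_
  rw [← ENNReal.ofReal_mul hc]
  ring_nf

theorem ENNReal.ofReal_finsetSum_le {ι : Type*} (s : Finset ι) (f : ι → ℝ) :
    ENNReal.ofReal (∑ i ∈ s, f i) ≤ ∑ i ∈ s, ENNReal.ofReal (f i) :=
  Finset.le_sum_of_subadditive _ ENNReal.ofReal_zero.le (fun _ _ => ENNReal.ofReal_add_le) _ _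

theorem relEnt_sum_le {ι : Type*} (s : Finset ι) (p b : ι → ℝ) :
    relEnt (∑ i ∈ s, p i) (∑ i ∈ s, b i) ≤ ∑ i ∈ s, relEnt (p i) (b i) := by
  refine iSup_le fun t => ?_
  rw [Finset.sum_mul, Finset.mul_sum, ← Finset.sum_add_distrib]
  exact (ENNReal.ofReal_finsetSum_le _ _).trans (Finset.sum_le_sum fun i _ => le_relEnt _ _ _)

/-- For each fixed `t` the expression is linear in `(p, b)`, so it passes to the limit of partial
sums before the supremum is taken. -/
theorem relEnt_tsum_le {p b : ℕ → ℝ} (hp : Summable p) (hb : Summable b) :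
    relEnt (∑' i, p i) (∑' i, b i) ≤ ∑' i, relEnt (p i) (b i) := by
  refine iSup_le fun t => ?_
  have h1 := ENNReal.tendsto_ofReal
    ((hp.hasSum.mul_right t).add (hb.hasSum.mul_left (1 - Real.exp t)))
  refine le_of_tendsto' h1 fun s => (ENNReal.ofReal_finsetSum_le _ _).trans ?_
  exact (Finset.sum_le_sum fun i _ => le_relEnt _ _ _).trans (ENNReal.sum_le_tsum s)

theorem relEnt_add_le (p b p' b' : ℝ) :
    relEnt (p + p') (b + b') ≤ relEnt p b + relEnt p' b' := by
  simpa using relEnt_sum_le Finset.univ ![p, p'] ![b, b']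

theorem lowerSemicontinuous_relEnt {X : Type*} [TopologicalSpace X] {f g : X → ℝ}
    (hf : Continuous f) (hg : Continuous g) : LowerSemicontinuous fun x => relEnt (f x) (g x) := by
  refine lowerSemicontinuous_iSup fun t => Continuous.lowerSemicontinuous ?_
  exact ENNReal.continuous_ofReal.comp (by fun_prop)

/-! ### Kullback–Leibler divergence on finite spaces and along filtrations -/

/-- `klDiv` is the integral of `klFun x = x log x + 1 - x` of the density; the terms `1 - x` match
the correction `b - p` in `relEnt`, so the identity holds pointwise and without equal total masses.
-/
theorem klDiv_eq_sum_relEnt {X : Type*} [Fintype X] [MeasurableSpace X]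
    [MeasurableSingletonClass X] (μ ν : Measure X) [IsFiniteMeasure μ] [IsFiniteMeasure ν] :
    klDiv μ ν = ∑ i, relEnt (μ.real {i}) (ν.real {i}) := by
  by_cases h : ∀ i, ν {i} = 0 → μ {i} = 0
  · have hac : μ ≪ ν := fun A hA => by
      rw [measure_null_iff_singleton (Set.to_countable A)] at hA ⊢
      exact fun i hi => h i (hA i hi)
    rw [klDiv_eq_lintegral_klFun_of_ac hac, lintegral_fintype]
    refine Finset.sum_congr rfl fun i _ => ?_
    have h1 := Measure.setLIntegral_rnDeriv hac {i}
    rw [lintegral_singleton] at h1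
    have h2 : μ.real {i} = (μ.rnDeriv ν i).toReal * ν.real {i} := by
      rw [Measure.real, ← h1, ENNReal.toReal_mul, Measure.real]
    rw [relEnt_eq measureReal_nonneg measureReal_nonneg (fun h0 => by simp [h2, h0])]
    rw [← ofReal_measureReal (μ := ν) (s := {i}), mul_comm,
      ← ENNReal.ofReal_mul measureReal_nonneg, h2, klFun_apply]
    congr 1
    rcases eq_or_ne (ν.real {i}) 0 with h0 | h0
    · simp [h0]
    · rw [mul_div_cancel_right₀ _ h0]
      ring
  · push Not at h
    obtain ⟨i, hi, hi'⟩ := h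
    rw [klDiv_of_not_ac fun hac => hi' (hac hi)]
    symm
    refine ENNReal.sum_eq_top.2 ⟨i, Finset.mem_univ i, ?_⟩
    rw [Measure.real, Measure.real, hi, ENNReal.toReal_zero]
    exact relEnt_zero_right (ENNReal.toReal_pos hi' (measure_ne_top _ _))

theorem relEnt_measureReal_le_klDiv {X : Type*} [Fintype X] [MeasurableSpace X]
    [MeasurableSingletonClass X] (μ ν : Measure X) [IsFiniteMeasure μ] [IsFiniteMeasure ν]
    (B : Set X) : relEnt (μ.real B) (ν.real B) ≤ klDiv μ ν := by
  classical
  have h (κ : Measure X) [IsFiniteMeasure κ] :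
      κ.real B = ∑ i ∈ Finset.univ.filter (· ∈ B), κ.real {i} := by
    rw [sum_measureReal_singleton]
    simp
  rw [klDiv_eq_sum_relEnt, h μ, h ν]
  exact (relEnt_sum_le _ _ _).trans (Finset.sum_le_sum_of_subset (Finset.filter_subset _ _))

theorem iSup_piLE_nat {S : Type*} [MeasurableSpace S] :
    ⨆ n, (Filtration.piLE (X := fun _ : ℕ => S) n : MeasurableSpace (ℕ → S)) =
    MeasurableSpace.pi := by
  refine le_antisymm (iSup_le fun n => Filtration.piLE.le n) ?_
  refine iSup_le fun n => le_trans ?_ (le_iSup _ n)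
  rw [Filtration.piLE_eq_comap_frestrictLe]
  refine Measurable.comap_le ?_
  exact (measurable_pi_apply (X := fun _ : Finset.Iic n => S) ⟨n, Finset.mem_Iic.2 le_rfl⟩).comp
    (comap_measurable _)

/-! ### Passage from finite horizons to infinite paths -/

section Limit

variable {S : Type*} [Fintype S] [MeasurableSpace S] [MeasurableSingletonClass S]

/-- A `ν`-null set `A` is approximated in both measures by cylinder events `B n`. The variational
inequality `μ(B n) t + (1 - exp t) ν(B n) ≤ K` becomes `μ(A) t ≤ K` in the limit, for every `t`,
which forces `μ(A) = 0`. -/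
theorem absolutelyContinuous_of_forall_klDiv_map_frestrictLe_le {μ ν : Measure (ℕ → S)}
    [IsFiniteMeasure μ] [IsFiniteMeasure ν] {K : ℝ≥0∞} (hK : K ≠ ⊤)
    (h : ∀ n : ℕ, klDiv (μ.map (Preorder.frestrictLe n)) (ν.map (Preorder.frestrictLe n)) ≤ K) :
    μ ≪ ν := by
  refine Measure.AbsolutelyContinuous.mk fun A hA hνA => ?_
  let g : (ℕ → S) → ℝ := A.indicator 1
  let f (n : ℕ) : (ℕ → S) → ℝ := (μ + ν)[g | Filtration.piLE (X := fun _ : ℕ => S) n]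
  let B (n : ℕ) : Set (ℕ → S) := {x | 1 / 2 < f n x}
  -- Lévy's upward theorem under `μ + ν`, so that convergence holds almost everywhere for both
  -- measures at once.
  have hlim : ∀ᵐ x ∂(μ + ν), Filter.Tendsto (fun n => f n x) Filter.atTop (nhds (g x)) := by
    have h1 := tendsto_ae_condExp (μ := μ + ν) (ℱ := Filtration.piLE (X := fun _ : ℕ => S)) g
    have h2 : (μ + ν)[g | ⨆ n, (Filtration.piLE (X := fun _ : ℕ => S) n)] = g := by
      rw [iSup_piLE_nat]
      exact condExp_of_stronglyMeasurable le_rfl (stronglyMeasurable_one.indicator hA)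
        ((integrable_const 1).indicator hA)
    rwa [h2] at h1
  have hind : ∀ᵐ x ∂(μ + ν), Filter.Tendsto
      (fun n => (B n).indicator (1 : (ℕ → S) → ℝ≥0∞) x) Filter.atTop
      (nhds (A.indicator (1 : (ℕ → S) → ℝ≥0∞) x)) := by
    filter_upwards [hlim] with x hx
    refine tendsto_const_nhds.congr' ?_
    by_cases hxA : x ∈ A
    · simp only [g, hxA, Set.indicator_of_mem, Pi.one_apply] at hx ⊢
      filter_upwards [hx.eventually (lt_mem_nhds (by norm_num : (1 / 2 : ℝ) < 1))] with n hn
      rw [Set.indicator_of_mem (by exact hn)]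
      rfl
    · simp only [g, hxA, Set.indicator_of_notMem, not_false_eq_true] at hx ⊢
      filter_upwards [hx.eventually (gt_mem_nhds (by norm_num : (0 : ℝ) < 1 / 2))] with n hn
      rw [Set.indicator_of_notMem (by exact fun h' : 1 / 2 < f n x => lt_asymm h' hn)]
  have hBm' (n : ℕ) :
      MeasurableSet[(Filtration.piLE (X := fun _ : ℕ => S) n : MeasurableSpace _)] (B n) :=
    stronglyMeasurable_condExp.measurable measurableSet_Ioi
  have hBm (n : ℕ) : MeasurableSet (B n) := Filtration.piLE.le n _ (hBm' n)
  have htend (κ : Measure (ℕ → S)) [IsFiniteMeasure κ] (hκ : κ ≪ μ + ν) :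
      Filter.Tendsto (fun n => κ.real (B n)) Filter.atTop (nhds (κ.real A)) := by
    refine (ENNReal.tendsto_toReal (measure_ne_top κ A)).comp ?_
    have h1 := tendsto_lintegral_of_dominated_convergence (μ := κ) (fun _ => (1 : ℝ≥0∞))
      (fun n => (measurable_one.indicator (hBm n)))
      (fun n => Filter.Eventually.of_forall fun x => Set.indicator_le_self' (by simp) x)
      (by simp) (hκ.ae_le hind)
    simpa [lintegral_indicator_one, hBm, hA] using h1
  have hμ := htend μ (Measure.AbsolutelyContinuous.rfl.add_right ν)
  have hν := htend ν (by
    rw [add_comm]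
    exact Measure.AbsolutelyContinuous.rfl.add_right μ)
  have hbound (t : ℝ) (n : ℕ) :
      μ.real (B n) * t + (1 - Real.exp t) * ν.real (B n) ≤ K.toReal := by
    have h1 := hBm' n
    rw [Filtration.piLE_eq_comap_frestrictLe] at h1
    obtain ⟨B', hB', hBB⟩ := h1
    have h2 := (le_relEnt _ _ t).trans ((relEnt_measureReal_le_klDiv
      (μ.map (Preorder.frestrictLe n)) (ν.map (Preorder.frestrictLe n)) B').trans (h n))
    rw [map_measureReal_apply (by fun_prop) hB', map_measureReal_apply (by fun_prop) hB', hBB] at h2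
    exact (ENNReal.ofReal_le_iff_le_toReal hK).1 h2
  have hfin (t : ℝ) : μ.real A * t ≤ K.toReal := by
    have h1 := le_of_tendsto' ((hμ.mul_const t).add (hν.const_mul (1 - Real.exp t))) (hbound t)
    simpa [Measure.real, hνA] using h1
  by_contra hne
  have hpos : 0 < μ.real A := ENNReal.toReal_pos hne (measure_ne_top _ _)
  have h1 := hfin ((K.toReal + 1) / μ.real A)
  rw [mul_div_cancel₀ _ hpos.ne'] at h1
  linarith

/-- The density of the restriction to the first coordinates is the conditional expectation of the
full density. These converge almost everywhere, and Fatou's lemma applies because `klFun` is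
continuous and the integrands are nonnegative. -/
theorem klDiv_le_of_forall_klDiv_map_frestrictLe_le {μ ν : Measure (ℕ → S)}
    [IsFiniteMeasure μ] [IsFiniteMeasure ν] {K : ℝ≥0∞}
    (h : ∀ n : ℕ, klDiv (μ.map (Preorder.frestrictLe n)) (ν.map (Preorder.frestrictLe n)) ≤ K) :
    klDiv μ ν ≤ K := by
  rcases eq_or_ne K ⊤ with rfl | hK
  · exact le_top
  have hac := absolutelyContinuous_of_forall_klDiv_map_frestrictLe_le hK h
  let g : (ℕ → S) → ℝ := fun x => (μ.rnDeriv ν x).toReal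
  have hg : ν[g | ⨆ n, (Filtration.piLE (X := fun _ : ℕ => S) n)] = g := by
    rw [iSup_piLE_nat]
    exact condExp_of_stronglyMeasurable le_rfl
      (Measure.measurable_rnDeriv μ ν).ennreal_toReal.stronglyMeasurable
      Measure.integrable_toReal_rnDeriv
  have hlim := tendsto_ae_condExp (μ := ν) (ℱ := Filtration.piLE (X := fun _ : ℕ => S)) g
  rw [hg] at hlim
  let F (n : ℕ) (x : ℕ → S) : ℝ≥0∞ :=
    ENNReal.ofReal (klFun ((ν[g | Filtration.piLE (X := fun _ : ℕ => S) n]) x))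
  have hF (n : ℕ) : ∫⁻ x, F n x ∂ν ≤ K := by
    refine le_trans (le_of_eq ?_) (h n)
    have hm : Measurable (Preorder.frestrictLe (π := fun _ : ℕ => S) n) := by fun_prop
    rw [klDiv_eq_lintegral_klFun_of_ac (hac.map hm), lintegral_map (by fun_prop) hm]
    refine lintegral_congr_ae ?_
    filter_upwards [toReal_rnDeriv_map hac hm] with x hx
    simp only [F]
    rw [hx, Filtration.piLE_eq_comap_frestrictLe]
  rw [klDiv_eq_lintegral_klFun_of_ac hac]
  calc ∫⁻ x, ENNReal.ofReal (klFun (μ.rnDeriv ν x).toReal) ∂ν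
      = ∫⁻ x, Filter.liminf (fun n => F n x) Filter.atTop ∂ν := by
        refine lintegral_congr_ae ?_
        filter_upwards [hlim] with x hx
        exact (((ENNReal.continuous_ofReal.comp continuous_klFun).tendsto _).comp
          hx).liminf_eq.symm
    _ ≤ Filter.liminf (fun n => ∫⁻ x, F n x ∂ν) Filter.atTop := by
        refine lintegral_liminf_le fun n => ?_
        have h1 : Measurable (ν[g | Filtration.piLE (X := fun _ : ℕ => S) n]) :=
          (stronglyMeasurable_condExp.mono (Filtration.piLE.le n)).measurable
        fun_prop
    _ ≤ K := Filter.liminf_le_of_frequently_le'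
        (Filter.Frequently.of_forall hF)

end Limit

/-! ### Marginals of the path measure and the chain rule for the path divergence -/

namespace MDP

theorem measurableSet_coord_eq {S : Type*} [MeasurableSpace S]
    [MeasurableSingletonClass S] (t : ℕ) (s : S) : MeasurableSet {ξ : ℕ → S | ξ t = s} :=
  measurable_pi_apply (X := fun _ : ℕ => S) t (measurableSet_singleton s)

variable {S A AP : Type*} [Fintype S] {M : MDP S A AP}

/-- The relative entropy of the successor distributions of two decision rules. -/
noncomputable def StationaryPolicy.divAt (μ η : M.StationaryPolicy) (s : S) : ℝ≥0∞ :=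
  ∑ q, relEnt (μ.trans s q) (η.trans s q)

variable [MeasurableSpace S] [MeasurableSingletonClass S]

instance (π : M.Policy) : IsProbabilityMeasure π.pathMeasure := by
  unfold Policy.pathMeasure
  infer_instance

/-- The probability of being in state `s` at time `t`. -/
noncomputable def Policy.marginal (π : M.Policy) (t : ℕ) (s : S) : ℝ :=
  π.pathMeasure.real {ξ | ξ t = s}

theorem Policy.marginal_nonneg (π : M.Policy) (t : ℕ) (s : S) : 0 ≤ π.marginal t s :=
  measureReal_nonneg

theorem Policy.ofReal_marginal (π : M.Policy) (t : ℕ) (s : S) :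
    ENNReal.ofReal (π.marginal t s) = π.pathMeasure {ξ | ξ t = s} :=
  ofReal_measureReal

theorem Policy.pathMeasure_map_frestrictLe_zero (π : M.Policy) :
    π.pathMeasure.map (Preorder.frestrictLe 0) = (Measure.dirac M.init).map
      (MeasurableEquiv.piUnique (fun _ : Finset.Iic 0 => S)).symm := by
  unfold Policy.pathMeasure Kernel.trajMeasure
  rw [Measure.map_comp _ _ (by fun_prop), Kernel.traj_map_frestrictLe, Kernel.partialTraj_self,
    Measure.id_comp]

theorem Policy.ae_coord_zero (π : M.Policy) : ∀ᵐ ξ ∂π.pathMeasure, ξ 0 = M.init := by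
  have h : ∀ᵐ w ∂(π.pathMeasure.map (Preorder.frestrictLe (π := fun _ : ℕ => S) 0)),
      w ⟨0, Finset.mem_Iic.2 le_rfl⟩ = M.init := by
    rw [π.pathMeasure_map_frestrictLe_zero, ae_map_iff
      (MeasurableEquiv.measurable _).aemeasurable (Set.Countable.measurableSet (Set.to_countable _)),
      ae_dirac_eq]
    rfl
  exact ae_of_ae_map (by fun_prop) h

open scoped Classical in
theorem Policy.marginal_zero (π : M.Policy) (s : S) :
    π.marginal 0 s = if s = M.init then 1 else 0 := by
  unfold Policy.marginal
  split_ifs with h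
  · rw [Measure.real, (prob_compl_eq_zero_iff (measurableSet_coord_eq 0 s)).1, ENNReal.toReal_one]
    · refine measure_eq_zero_iff_ae_notMem.2 ?_
      filter_upwards [π.ae_coord_zero] with ξ hξ
      simpa [h] using hξ
  · rw [measureReal_eq_zero_iff]
    refine measure_eq_zero_iff_ae_notMem.2 ?_
    filter_upwards [π.ae_coord_zero] with ξ hξ h'
    exact h (h'.symm.trans hξ)

theorem StationaryPolicy.next_toMeasure_singleton (μ : M.StationaryPolicy) (s q : S) :
    (μ.next s).toMeasure {q} = ENNReal.ofReal (μ.trans s q) := by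
  rw [PMF.toMeasure_apply_singleton _ _ (measurableSet_singleton q)]
  rfl

theorem Policy.kernel_apply (π : M.Policy) (n : ℕ) (w : (i : Finset.Iic n) → S) :
    π.kernel n w = ((π n).next (w ⟨n, Finset.mem_Iic.2 le_rfl⟩)).toMeasure := rfl

theorem Policy.pathMeasure_pair (π : M.Policy) (n : ℕ) (s q : S) :
    π.pathMeasure {ξ | ξ n = s ∧ ξ (n + 1) = q} =
      π.pathMeasure {ξ | ξ n = s} * ENNReal.ofReal ((π n).trans s q) := by
  have h := Kernel.map_frestrictLe_trajMeasure_compProd_eq_map_trajMeasure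
    (X := fun _ : ℕ => S) (μ₀ := Measure.dirac M.init) (κ := π.kernel) (a := n)
  let l : Finset.Iic n := ⟨n, Finset.mem_Iic.2 le_rfl⟩
  let B : Set (((i : Finset.Iic n) → S) × S) := {p | p.1 l = s ∧ p.2 = q}
  have hB : MeasurableSet B := Set.Countable.measurableSet (Set.to_countable B)
  have hm : Measurable (Preorder.frestrictLe (π := fun _ : ℕ => S) n) := by fun_prop
  calc π.pathMeasure {ξ | ξ n = s ∧ ξ (n + 1) = q}
      = (π.pathMeasure.map fun x => (Preorder.frestrictLe n x, x (n + 1))) B := by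
        rw [Measure.map_apply (by fun_prop) hB]
        rfl
    _ = ((π.pathMeasure.map (Preorder.frestrictLe n)) ⊗ₘ π.kernel n) B :=
        (congrArg (fun κ : Measure (((i : Finset.Iic n) → S) × S) => κ B) h).symm
    _ = ∫⁻ ξ, π.kernel n (Preorder.frestrictLe n ξ) (Prod.mk (Preorder.frestrictLe n ξ) ⁻¹' B)
          ∂π.pathMeasure := by
        rw [Measure.compProd_apply hB, lintegral_map (measurable_of_countable _) hm]
    _ = ∫⁻ ξ, {ξ : ℕ → S | ξ n = s}.indicator
          (fun _ => ENNReal.ofReal ((π n).trans s q)) ξ ∂π.pathMeasure := by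
        refine lintegral_congr fun ξ => ?_
        rw [π.kernel_apply]
        by_cases hξ : ξ n = s
        · rw [Set.indicator_of_mem (by exact hξ), ← StationaryPolicy.next_toMeasure_singleton, ← hξ]
          congr 1
          ext q'
          simp [B, l, hξ]
        · rw [Set.indicator_of_notMem (by exact hξ)]
          have h0 : Prod.mk (Preorder.frestrictLe (π := fun _ : ℕ => S) n ξ) ⁻¹' B = ∅ := by
            refine Set.eq_empty_of_forall_notMem fun q' h' => hξ h'.1
          rw [h0, measure_empty]
    _ = π.pathMeasure {ξ | ξ n = s} * ENNReal.ofReal ((π n).trans s q) := by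
        rw [lintegral_indicator_const (measurableSet_coord_eq n s), mul_comm]

theorem Policy.marginal_pair (π : M.Policy) (n : ℕ) (s q : S) :
    π.pathMeasure.real {ξ | ξ n = s ∧ ξ (n + 1) = q} = π.marginal n s * (π n).trans s q := by
  rw [Measure.real, π.pathMeasure_pair, ENNReal.toReal_mul,
    ENNReal.toReal_ofReal ((π n).trans_nonneg s q)]
  rfl

theorem Policy.marginal_succ (π : M.Policy) (n : ℕ) (q : S) :
    π.marginal (n + 1) q = ∑ s, π.marginal n s * (π n).trans s q := by
  have h : {ξ : ℕ → S | ξ (n + 1) = q} =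
      ⋃ s ∈ (Finset.univ : Finset S), {ξ | ξ n = s ∧ ξ (n + 1) = q} := by
    ext ξ
    simp
  unfold Policy.marginal
  rw [h, measureReal_biUnion_finset]
  · exact Finset.sum_congr rfl fun s _ => π.marginal_pair n s q
  · intro s _ s' _ hs
    refine Set.disjoint_left.2 fun ξ h1 h2 => hs (h1.1.symm.trans h2.1)
  · exact fun s _ => (measurableSet_coord_eq n s).inter (measurableSet_coord_eq (n + 1) q)

theorem Policy.klDiv_map_frestrictLe_succ (π η : M.Policy) (n : ℕ) :
    klDiv (π.pathMeasure.map (Preorder.frestrictLe (n + 1)))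
        (η.pathMeasure.map (Preorder.frestrictLe (n + 1))) =
      klDiv (π.pathMeasure.map (Preorder.frestrictLe n))
        (η.pathMeasure.map (Preorder.frestrictLe n)) +
      ∑ s, ENNReal.ofReal (π.marginal n s) * (π n).divAt (η n) s := by
  classical
  let l : Finset.Iic n := ⟨n, Finset.mem_Iic.2 le_rfl⟩
  let μ := π.pathMeasure.map (Preorder.frestrictLe (π := fun _ : ℕ => S) n)
  let ν := η.pathMeasure.map (Preorder.frestrictLe (π := fun _ : ℕ => S) n)
  have hm (n : ℕ) : Measurable (Preorder.frestrictLe (π := fun _ : ℕ => S) n) := by fun_prop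
  have : IsProbabilityMeasure μ := Measure.isProbabilityMeasure_map (hm n).aemeasurable
  have : IsProbabilityMeasure ν := Measure.isProbabilityMeasure_map (hm n).aemeasurable
  let g : (ℕ → S) → ((i : Finset.Iic n) → S) × S :=
    fun x => (Preorder.frestrictLe (π := fun _ : ℕ => S) n x, x (n + 1))
  have hg : Measurable g := by fun_prop
  have hpair (π : M.Policy) : (π.pathMeasure.map (Preorder.frestrictLe n)) ⊗ₘ π.kernel n =
      π.pathMeasure.map g :=
    Kernel.map_frestrictLe_trajMeasure_compProd_eq_map_trajMeasure
      (X := fun _ : ℕ => S) (μ₀ := Measure.dirac M.init) (κ := π.kernel) (a := n)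
  have hsplit : klDiv (π.pathMeasure.map (Preorder.frestrictLe (n + 1)))
      (η.pathMeasure.map (Preorder.frestrictLe (n + 1))) =
      klDiv (π.pathMeasure.map g) (η.pathMeasure.map g) := by
    -- A path up to `n + 1` and the pair of its first part and last state are functions of each
    -- other; data processing in both directions gives equality.
    refine le_antisymm ?_ ?_
    · let e : ((i : Finset.Iic n) → S) × S → ((i : Finset.Iic (n + 1)) → S) := fun p i =>
        if h : (i : ℕ) ≤ n then p.1 ⟨i, Finset.mem_Iic.2 h⟩ else p.2
      have he : Preorder.frestrictLe (π := fun _ : ℕ => S) (n + 1) = e ∘ g := by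
        funext x i
        have hi := Finset.mem_Iic.1 i.2
        by_cases h : (i : ℕ) ≤ n
        · simp [e, g, h]
        · have h' : (i : ℕ) = n + 1 := by omega
          simp [e, g, h']
      rw [he, ← Measure.map_map (measurable_of_countable e) hg,
        ← Measure.map_map (measurable_of_countable e) hg]
      exact klDiv_map_le _ _ (measurable_of_countable e)
    · let e : ((i : Finset.Iic (n + 1)) → S) → ((i : Finset.Iic n) → S) × S := fun w =>
        (fun i => w ⟨i, Finset.mem_Iic.2 ((Finset.mem_Iic.1 i.2).trans n.le_succ)⟩,
          w ⟨n + 1, Finset.mem_Iic.2 le_rfl⟩)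
      have he : g = e ∘ Preorder.frestrictLe (π := fun _ : ℕ => S) (n + 1) := rfl
      rw [he, ← Measure.map_map (measurable_of_countable e) (hm _),
        ← Measure.map_map (measurable_of_countable e) (hm _)]
      exact klDiv_map_le _ _ (measurable_of_countable e)
  have hreal (π : M.Policy) (w : (i : Finset.Iic n) → S) (q : S) :
      (μ ⊗ₘ π.kernel n).real {(w, q)} = μ.real {w} * (π n).trans (w l) q := by
    rw [Measure.real, ← Set.singleton_prod_singleton, Measure.compProd_apply_prod
      (measurableSet_singleton w) (measurableSet_singleton q), lintegral_singleton,
      ENNReal.toReal_mul, π.kernel_apply, StationaryPolicy.next_toMeasure_singleton,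
      ENNReal.toReal_ofReal ((π n).trans_nonneg _ q), mul_comm]
    rfl
  have hstep : klDiv (μ ⊗ₘ π.kernel n) (μ ⊗ₘ η.kernel n) =
      ∑ s, ENNReal.ofReal (π.marginal n s) * (π n).divAt (η n) s := by
    rw [klDiv_eq_sum_relEnt, Fintype.sum_prod_type]
    calc _ = ∑ w, (π n).divAt (η n) (w l) * μ {w} := by
          refine Finset.sum_congr rfl fun w _ => ?_
          rw [StationaryPolicy.divAt, mul_comm, Finset.mul_sum]
          refine Finset.sum_congr rfl fun q _ => ?_
          rw [hreal, hreal, relEnt_mul measureReal_nonneg, ofReal_measureReal]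
      _ = ∫⁻ ξ, (π n).divAt (η n) (ξ n) ∂π.pathMeasure := by
          rw [← lintegral_fintype, lintegral_map (measurable_of_countable _) (hm n)]
          rfl
      _ = ∫⁻ s, (π n).divAt (η n) s ∂(π.pathMeasure.map fun ξ => ξ n) := by
          rw [lintegral_map (measurable_of_countable _) (by fun_prop)]
      _ = _ := by
          rw [lintegral_fintype]
          refine Finset.sum_congr rfl fun s _ => ?_
          rw [Measure.map_apply (by fun_prop) (measurableSet_singleton s), mul_comm,
            π.ofReal_marginal]
          rfl
  rw [hsplit, ← hpair, ← hpair, klDiv_compProd_eq_add]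
  exact congrArg _ hstep

theorem pathKL_eq_tsum (π : M.Policy) (πS : M.StationaryPolicy) :
    pathKL π πS = ∑' t, ∑ s, ENNReal.ofReal (π.marginal t s) * (π t).divAt πS s := by
  have h (n : ℕ) : klDiv (π.pathMeasure.map (Preorder.frestrictLe n))
      (πS.toPolicy.pathMeasure.map (Preorder.frestrictLe n)) =
      ∑ t ∈ Finset.range n, ∑ s, ENNReal.ofReal (π.marginal t s) * (π t).divAt πS s := by
    induction n with
    | zero =>
      rw [π.pathMeasure_map_frestrictLe_zero, πS.toPolicy.pathMeasure_map_frestrictLe_zero]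
      simp
    | succ n ih =>
      rw [Policy.klDiv_map_frestrictLe_succ, ih, Finset.sum_range_succ]
      rfl
  refine le_antisymm (klDiv_le_of_forall_klDiv_map_frestrictLe_le fun n => ?_) ?_
  · rw [h]
    exact ENNReal.sum_le_tsum _
  · rw [ENNReal.tsum_eq_iSup_nat]
    refine iSup_le fun n => ?_
    rw [← h]
    exact klDiv_map_le _ _ (by fun_prop)

end MDP

namespace MDP

variable {S A AP : Type*} [Fintype S] {M : MDP S A AP}

/-! ### Accessibility and closed classes -/

theorem StationaryPolicy.mem_Succ_of_trans_pos {π : M.StationaryPolicy} {s q : S}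
    (h : 0 < π.trans s q) : q ∈ M.Succ s := by
  obtain ⟨a, ha, h1⟩ := Finset.exists_ne_zero_of_sum_ne_zero h.ne'
  exact ⟨a, ha, (M.prob_nonneg s a q).lt_of_ne' (left_ne_zero_of_mul h1)⟩

theorem StationaryPolicy.trans_le_one (π : M.StationaryPolicy) (s q : S) : π.trans s q ≤ 1 := by
  rw [← π.trans_sum s]
  exact Finset.single_le_sum (fun q _ => π.trans_nonneg s q) (Finset.mem_univ q)

theorem StationaryPolicy.closedStates_of_trans_pos {π : M.StationaryPolicy} {s q : S}
    (hs : s ∈ π.closedStates) (h : 0 < π.trans s q) :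
    q ∈ π.closedStates ∧ π.Accessible q s := by
  obtain ⟨D, hD, hsD⟩ := hs
  have hq : q ∈ D := by
    by_contra hq
    exact hD.2 s hsD q hq (Relation.ReflTransGen.single h)
  exact ⟨⟨D, hD, hq⟩, (hD.1 s hsD q hq).2⟩

/-- Among the states accessible from `s`, one with the fewest accessible states works: each state it
leads to has the same accessible set, hence leads back. -/
theorem StationaryPolicy.exists_accessible_closedStates (π : M.StationaryPolicy) (s : S) :
    ∃ c ∈ π.closedStates, π.Accessible s c := by
  classical
  let Acc (u : S) : Finset S := Finset.univ.filter fun v => π.Accessible u v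
  have hAcc (u v : S) : v ∈ Acc u ↔ π.Accessible u v := by
    simp only [Acc, Finset.mem_filter, Finset.mem_univ, true_and]
  obtain ⟨c, hc, hmin⟩ := Finset.exists_min_image (Acc s) (fun u => (Acc u).card)
    ⟨s, (hAcc s s).2 .refl⟩
  have hsc : π.Accessible s c := (hAcc s c).1 hc
  have hback (v : S) (hv : π.Accessible c v) : π.Accessible v c := by
    have hsub : Acc v ⊆ Acc c := fun w hw => (hAcc c w).2 (hv.trans ((hAcc v w).1 hw))
    have heq := Finset.eq_of_subset_of_card_le hsub (hmin v ((hAcc s v).2 (hsc.trans hv)))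
    exact (hAcc v c).1 (heq ▸ (hAcc c c).2 .refl)
  refine ⟨c, ⟨{v | π.Accessible c v}, ⟨fun u hu v hv => ?_, fun u hu v hv huv => ?_⟩, .refl⟩, hsc⟩
  · exact ⟨(hback u hu).trans hv, (hback v hv).trans hu⟩
  · exact hv (Relation.ReflTransGen.trans hu huv)

/-- The rank is the least number of possible moves needed to reach a closed class. -/
theorem StationaryPolicy.exists_rank (π : M.StationaryPolicy) :
    ∃ d : S → ℕ, ∀ s ∉ π.closedStates, ∃ q, 0 < π.trans s q ∧ d q < d s := by
  classical
  let L (k : ℕ) : Set S := 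
    Nat.rec (motive := fun _ => Set S) π.closedStates
      (fun _ T => {s | ∃ q ∈ T, 0 < π.trans s q}) k
  have hL (s : S) : ∃ k, s ∈ L k := by
    obtain ⟨c, hc, hsc⟩ := π.exists_accessible_closedStates s
    refine Relation.ReflTransGen.head_induction_on hsc ⟨0, hc⟩ fun h _ ih => ?_
    obtain ⟨k, hk⟩ := ih
    exact ⟨k + 1, _, hk, h⟩
  refine ⟨fun s => Nat.find (hL s), fun s hs => ?_⟩
  have h1 : s ∈ L (Nat.find (hL s)) := Nat.find_spec (hL s)
  rcases hk : Nat.find (hL s) with _ | k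
  · rw [hk] at h1
    exact absurd h1 hs
  · rw [hk] at h1
    obtain ⟨q, hq, hpos⟩ := h1
    have h2 : Nat.find (hL q) ≤ k := Nat.find_min' (hL q) hq
    exact ⟨q, hpos, (h2.trans_lt k.lt_succ_self).trans_eq hk.symm⟩

theorem StationaryPolicy.exists_trans_lower_bound (π : M.StationaryPolicy) :
    ∃ m : ℝ, 0 < m ∧ m ≤ 1 ∧ ∀ s q, 0 < π.trans s q → m ≤ π.trans s q := by
  classical
  let F : Finset (S × S) := Finset.univ.filter fun p => 0 < π.trans p.1 p.2
  rcases F.eq_empty_or_nonempty with hF | hF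
  · refine ⟨1, one_pos, le_rfl, fun s q h => ?_⟩
    have : (s, q) ∈ F := by simpa [F] using h
    simp [hF] at this
  · obtain ⟨p, hp, hmin⟩ := F.exists_min_image (fun p => π.trans p.1 p.2) hF
    refine ⟨π.trans p.1 p.2, (Finset.mem_filter.1 hp).2, π.trans_le_one _ _, fun s q h => ?_⟩
    exact hmin (s, q) (by simpa [F] using h)

open scoped Classical in
/-- A Lyapunov function for the time that the chain spends outside its closed classes. -/
theorem StationaryPolicy.exists_potential (π : M.StationaryPolicy) :
    ∃ (v : S → ℝ) (ε : ℝ), (∀ s, 0 ≤ v s) ∧ 0 < ε ∧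
      ∀ s, ∑ q, π.trans s q *
        Real.exp (v q + (if s ∈ π.closedStates then 0 else ε) - v s) ≤ 1 := by
  obtain ⟨d, hd⟩ := π.exists_rank
  obtain ⟨m, hm, hm1, hmin⟩ := π.exists_trans_lower_bound
  -- The shift by one makes the rank zero on all closed states and positive elsewhere, so that rank
  -- zero characterises them.
  let d' (s : S) : ℕ := if s ∈ π.closedStates then 0 else d s + 1
  have hd' (s : S) (hs : s ∉ π.closedStates) : ∃ q, 0 < π.trans s q ∧ d' q < d' s := by
    obtain ⟨q, hq, hlt⟩ := hd s hs
    refine ⟨q, hq, ?_⟩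
    simp only [d', hs, if_false]
    split_ifs <;> omega
  let n := Finset.univ.sup d'
  have hn (s : S) : d' s ≤ n := Finset.le_sup (Finset.mem_univ s)
  -- A rank-decreasing move has probability at least `m` and multiplies `u` by at least `r`, so it
  -- alone contributes `2 * u s ≥ u s + 1` to the mean of `u`.
  let r : ℝ := 2 / m
  have hr : 1 ≤ r := by rw [le_div_iff₀ hm]; linarith
  let u (s : S) : ℝ := r ^ (n - d' s)
  have hu1 (s : S) : 1 ≤ u s := one_le_pow₀ hr
  have huU (s : S) : u s ≤ r ^ n := pow_le_pow_right₀ hr (Nat.sub_le _ _)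
  -- `g` takes values in `[1, r ^ n]`, equals `1` on closed states, and drops by at least `1` in
  -- mean elsewhere; `v = log g` turns this additive drop into the exponential inequality.
  let g (s : S) : ℝ := 1 + r ^ n - u s
  have hg1 (s : S) : 1 ≤ g s := by simp only [g]; linarith [huU s]
  have hgpos (s : S) : 0 < g s := one_pos.trans_le (hg1 s)
  have hsum (s : S) : ∑ q, π.trans s q * g q = 1 + r ^ n - ∑ q, π.trans s q * u q := by
    simp only [g, mul_sub, Finset.sum_sub_distrib, ← Finset.sum_mul, π.trans_sum, one_mul]
  have hU : 0 < 1 + r ^ n := by positivity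
  refine ⟨fun s => Real.log (g s), 1 / (1 + r ^ n), fun s => Real.log_nonneg (hg1 s),
    by positivity, fun s => ?_⟩
  have h1 (e : ℝ) : ∑ q, π.trans s q * Real.exp (Real.log (g q) + e - Real.log (g s)) =
      (∑ q, π.trans s q * g q) * (Real.exp e / g s) := by
    rw [Finset.sum_mul]
    refine Finset.sum_congr rfl fun q _ => ?_
    rw [Real.exp_sub, Real.exp_add, Real.exp_log (hgpos q), Real.exp_log (hgpos s)]
    ring
  rw [h1, hsum, mul_div_assoc', div_le_one (hgpos s)]
  split_ifs with hs
  · have h2 : ∑ q, π.trans s q * u q = r ^ n := by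
      rw [← one_mul (r ^ n), ← π.trans_sum s, Finset.sum_mul]
      refine Finset.sum_congr rfl fun q _ => ?_
      rcases (π.trans_nonneg s q).eq_or_lt with h0 | h0
      · rw [← h0, zero_mul, zero_mul]
      · have h3 := (closedStates_of_trans_pos hs h0).1
        simp [u, d', h3]
    rw [h2, Real.exp_zero]
    linarith [hg1 s]
  · obtain ⟨q, hq, hlt⟩ := hd' s hs
    have h2 : u s + 1 ≤ ∑ q, π.trans s q * u q := by
      have h3 : π.trans s q * u q ≤ ∑ q, π.trans s q * u q :=
        Finset.single_le_sum (f := fun q => π.trans s q * u q)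
          (fun q _ => mul_nonneg (π.trans_nonneg s q) (zero_le_one.trans (hu1 q)))
          (Finset.mem_univ q)
      have h4 : r * u s ≤ u q := by
        simp only [u]
        rw [← pow_succ']
        exact pow_le_pow_right₀ hr (by have := hn s; omega)
      have h5 : m * (r * u s) ≤ π.trans s q * u q :=
        mul_le_mul (hmin s q hq) h4 (by positivity) (π.trans_nonneg s q)
      have h6 : m * (r * u s) = 2 * u s := by
        simp only [r]
        field_simp
      linarith [hu1 s]
    -- Since `g s ≤ 1 + r ^ n`, subtracting `1` is at least as strong as multiplying by `1 - 1 / (1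
    -- + r ^ n)`; this explains the choice of `ε`.
    have h3 : g s - 1 ≤ g s * Real.exp (-(1 / (1 + r ^ n))) := by
      have h4 := Real.one_sub_le_exp_neg (1 / (1 + r ^ n))
      have h5 : g s * (1 / (1 + r ^ n)) ≤ 1 := by
        rw [mul_one_div, div_le_one hU]
        simp only [g]
        linarith [hu1 s]
      nlinarith [mul_le_mul_of_nonneg_left h4 (hgpos s).le]
    have h4 : 1 + r ^ n - ∑ q, π.trans s q * u q ≤ g s - 1 := by
      simp only [g]
      linarith
    calc _ ≤ (g s * Real.exp (-(1 / (1 + r ^ n)))) * Real.exp (1 / (1 + r ^ n)) :=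
          mul_le_mul_of_nonneg_right (h4.trans h3) (Real.exp_pos _).le
      _ = g s := by rw [mul_assoc, ← Real.exp_add, neg_add_cancel, Real.exp_zero, mul_one]

/-- The Donsker–Varadhan bound with test function `v q + e - v s`. It makes the divergence of a step
dominate the mean increase of the potential plus `e`, which can then be telescoped. -/
theorem ofReal_potential_le_sum_relEnt (π : M.StationaryPolicy) (v : S → ℝ) (e : ℝ) (s : S)
    (h : ∑ q, π.trans s q * Real.exp (v q + e - v s) ≤ 1) {c : ℝ} (hc : 0 ≤ c) (p : S → ℝ)
    (hp : ∑ q, p q = c) :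
    ENNReal.ofReal (∑ q, p q * v q + c * (e - v s)) ≤
      ∑ q, relEnt (p q) (π.trans s q * c) := by
  refine le_trans ?_ ((ENNReal.ofReal_finsetSum_le _ _).trans (Finset.sum_le_sum fun q _ =>
    le_relEnt (p q) (π.trans s q * c) (v q + e - v s)))
  refine ENNReal.ofReal_le_ofReal ?_
  have h1 : ∑ q, (p q * (v q + e - v s) +
      (1 - Real.exp (v q + e - v s)) * (π.trans s q * c)) =
      (∑ q, p q * v q + c * (e - v s)) +
        c * (1 - ∑ q, π.trans s q * Real.exp (v q + e - v s)) := by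
    calc _ = ∑ q, (p q * v q + p q * (e - v s) + π.trans s q * c -
          c * (π.trans s q * Real.exp (v q + e - v s))) :=
          Finset.sum_congr rfl fun q _ => by ring
      _ = _ := by
          rw [Finset.sum_sub_distrib, Finset.sum_add_distrib, Finset.sum_add_distrib,
            ← Finset.sum_mul, ← Finset.sum_mul, ← Finset.mul_sum, π.trans_sum, hp]
          ring
  rw [h1]
  have := mul_nonneg hc (sub_nonneg.2 h)
  linarith

/-! ### Target sets that are absorbing on the reachable states -/

/-- `R` contains the initial state and is closed under all moves, and no move leads from
`R ∩ C` out of `C`. -/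
structure IsAbsorbingOn (M : MDP S A AP) (R C : Set S) : Prop where
  init_mem : M.init ∈ R
  closed : ∀ s ∈ R, ∀ q ∈ M.Succ s, q ∈ R
  absorbing : ∀ s ∈ R, s ∈ C → ∀ q ∈ M.Succ s, q ∈ C

theorem IsAbsorbingOn.mem_of_accessible {R C : Set S} (h : M.IsAbsorbingOn R C)
    {π : M.StationaryPolicy} {s q : S} (hsq : π.Accessible s q) (hs : s ∈ R ∩ C) : q ∈ R ∩ C := by
  induction hsq with
  | refl => exact hs
  | tail _ hbc ih =>
    have := StationaryPolicy.mem_Succ_of_trans_pos hbc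
    exact ⟨h.closed _ ih.1 _ this, h.absorbing _ ih.1 ih.2 _ this⟩

/-- A move into `C` would stay in the closed class of `s`, from which `s` is accessible again,
contradicting that `C` is absorbing on `R`. -/
theorem IsAbsorbingOn.trans_eq_zero_of_mem_closedStates {R C : Set S} (h : M.IsAbsorbingOn R C)
    {π : M.StationaryPolicy} {s q : S} (hs : s ∈ R) (hsC : s ∉ C) (hcl : s ∈ π.closedStates)
    (hq : q ∈ C) : π.trans s q = 0 := by
  by_contra hne
  have hpos := (π.trans_nonneg s q).lt_of_ne' hne
  have hqR := h.closed s hs q (StationaryPolicy.mem_Succ_of_trans_pos hpos)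
  exact hsC (h.mem_of_accessible (StationaryPolicy.closedStates_of_trans_pos hcl hpos).2
    ⟨hqR, hq⟩).2

theorem mem_diffStates {πS : M.StationaryPolicy} {C : Set S} {s : S} :
    s ∈ diffStates πS C ↔ s ∉ πS.closedStates ∧ s ∉ C := by
  simp [diffStates]

end MDP

namespace MDP

variable {S A AP : Type*} [Fintype S] {M : MDP S A AP}
  [MeasurableSpace S] [MeasurableSingletonClass S]

/-! ### Occupation measures of policies dominated by the reference policy -/

/-- All transitions that have positive probability under `π` are possible under `πS`. -/
def Policy.IsDominatedBy (π : M.Policy) (πS : M.StationaryPolicy) : Prop :=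
  ∀ t s q, 0 < π.marginal t s → 0 < (π t).trans s q → 0 < πS.trans s q

theorem Policy.isDominatedBy_of_pathKL_ne_top {π : M.Policy} {πS : M.StationaryPolicy}
    (h : pathKL π πS ≠ ⊤) : π.IsDominatedBy πS := by
  intro t s q hm hp
  refine (πS.trans_nonneg s q).lt_of_ne' fun h0 => h ?_
  rw [pathKL_eq_tsum]
  refine ENNReal.tsum_eq_top_of_eq_top ⟨t, ENNReal.sum_eq_top.2 ⟨s, Finset.mem_univ s, ?_⟩⟩
  refine ENNReal.mul_eq_top.2 (Or.inl ⟨by simpa using hm, ENNReal.sum_eq_top.2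
    ⟨q, Finset.mem_univ q, ?_⟩⟩)
  rw [h0]
  exact relEnt_zero_right hp

/-- The potential bound is summed over time: the increments of the mean potential telescope, leaving
`ε` times the residence time outside the closed classes bounded by the divergence plus the initial
potential. -/
theorem Policy.summable_marginal {π : M.Policy} {πS : M.StationaryPolicy}
    (h : pathKL π πS ≠ ⊤) {s : S} (hs : s ∉ πS.closedStates) :
    Summable fun t => π.marginal t s := by
  classical
  obtain ⟨v, ε, hv, hε, hpot⟩ := πS.exists_potential
  let e (s : S) : ℝ := if s ∈ πS.closedStates then 0 else ε
  have he (s : S) : 0 ≤ e s := by simp only [e]; split_ifs <;> [exact le_rfl; exact hε.le]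
  let V (t : ℕ) : ℝ := ∑ s, π.marginal t s * v s
  have hV (t : ℕ) : 0 ≤ V t :=
    Finset.sum_nonneg fun s _ => mul_nonneg (π.marginal_nonneg t s) (hv s)
  let I (t : ℕ) : ℝ := ∑ s, π.marginal t s * (∑ q, (π t).trans s q * v q + 1 * (e s - v s))
  have hI (t : ℕ) : I t = V (t + 1) - V t + ∑ s, π.marginal t s * e s := by
    simp only [I, V, π.marginal_succ, Finset.sum_mul]
    rw [Finset.sum_comm, ← Finset.sum_sub_distrib, ← Finset.sum_add_distrib]
    refine Finset.sum_congr rfl fun s _ => ?_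
    rw [one_mul, mul_add, Finset.mul_sum]
    have : ∑ q, π.marginal t s * (π t).trans s q * v q =
        ∑ q, π.marginal t s * ((π t).trans s q * v q) :=
      Finset.sum_congr rfl fun q _ => mul_assoc _ _ _
    rw [this]
    ring
  have hle (n : ℕ) : ∑ t ∈ Finset.range n, I t ≤ (pathKL π πS).toReal := by
    refine (ENNReal.ofReal_le_iff_le_toReal h).1 ?_
    rw [pathKL_eq_tsum]
    refine (ENNReal.ofReal_finsetSum_le _ _).trans (le_trans (Finset.sum_le_sum fun t _ => ?_)
      (ENNReal.sum_le_tsum _))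
    refine (ENNReal.ofReal_finsetSum_le _ _).trans (Finset.sum_le_sum fun s _ => ?_)
    rw [ENNReal.ofReal_mul (π.marginal_nonneg t s)]
    gcongr
    simpa [StationaryPolicy.divAt] using ofReal_potential_le_sum_relEnt πS v (e s) s (hpot s)
      zero_le_one ((π t).trans s) ((π t).trans_sum s)
  refine summable_of_sum_range_le (c := ((pathKL π πS).toReal + V 0) / ε)
    (fun t => π.marginal_nonneg t s) fun n => ?_
  rw [le_div_iff₀ hε, Finset.sum_mul]
  have h1 := hle n
  simp only [hI, Finset.sum_add_distrib, Finset.sum_range_sub] at h1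
  have h2 : ∑ t ∈ Finset.range n, π.marginal t s * ε ≤
      ∑ t ∈ Finset.range n, ∑ s, π.marginal t s * e s := by
    refine Finset.sum_le_sum fun t _ => ?_
    have h3 := Finset.single_le_sum (f := fun s => π.marginal t s * e s)
      (fun s _ => mul_nonneg (π.marginal_nonneg t s) (he s)) (Finset.mem_univ s)
    simpa [e, hs] using h3
  linarith [hV n]

theorem IsAbsorbingOn.mem_of_marginal_pos {R C : Set S} (h : M.IsAbsorbingOn R C) (π : M.Policy)
    {t : ℕ} {s : S} (hs : 0 < π.marginal t s) : s ∈ R := by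
  classical
  induction t generalizing s with
  | zero =>
    rw [π.marginal_zero] at hs
    split_ifs at hs with h0
    · rw [h0]
      exact h.init_mem
    · exact absurd hs (lt_irrefl 0)
  | succ t ih =>
    rw [π.marginal_succ] at hs
    obtain ⟨q, -, hq⟩ := Finset.exists_ne_zero_of_sum_ne_zero hs.ne'
    exact h.closed q (ih ((π.marginal_nonneg t q).lt_of_ne' (left_ne_zero_of_mul hq))) s
      (StationaryPolicy.mem_Succ_of_trans_pos
        (((π t).trans_nonneg q s).lt_of_ne' (right_ne_zero_of_mul hq)))

/-! ### Flow balance and reachability for an absorbing target -/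

section Absorbing

variable {R C : Set S} (h : M.IsAbsorbingOn R C) {π : M.Policy} {πS : M.StationaryPolicy}
include h

theorem IsAbsorbingOn.marginal_mul_trans_eq_zero_of_mem (π : M.Policy) {t : ℕ} {s q : S}
    (hs : s ∈ C) (hq : q ∉ C) : π.marginal t s * (π t).trans s q = 0 := by
  by_contra hne
  have hm := (π.marginal_nonneg t s).lt_of_ne' (left_ne_zero_of_mul hne)
  have hp := ((π t).trans_nonneg s q).lt_of_ne' (right_ne_zero_of_mul hne)
  exact hq (h.absorbing s (h.mem_of_marginal_pos π hm) hs q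
    (StationaryPolicy.mem_Succ_of_trans_pos hp))

/-- The set `diffStates` is never re-entered: `C` is absorbing, and a dominated policy cannot leave
a closed class of the reference chain. -/
theorem IsAbsorbingOn.marginal_mul_trans_eq_zero (hdom : π.IsDominatedBy πS) {t : ℕ} {s q : S}
    (hs : s ∉ diffStates πS C) (hq : q ∈ diffStates πS C) :
    π.marginal t s * (π t).trans s q = 0 := by
  rw [mem_diffStates] at hs hq
  by_cases hsC : s ∈ C
  · exact h.marginal_mul_trans_eq_zero_of_mem π hsC hq.2
  · by_contra hne
    have hm := (π.marginal_nonneg t s).lt_of_ne' (left_ne_zero_of_mul hne)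
    have hp := ((π t).trans_nonneg s q).lt_of_ne' (right_ne_zero_of_mul hne)
    have hcl : s ∈ πS.closedStates := by tauto
    exact hq.1 (StationaryPolicy.closedStates_of_trans_pos hcl (hdom t s q hm hp)).1

theorem IsAbsorbingOn.marginal_succ (hdom : π.IsDominatedBy πS) (t : ℕ) {q : S}
    (hq : q ∈ diffStates πS C) :
    π.marginal (t + 1) q = ∑ s ∈ diffStates πS C, π.marginal t s * (π t).trans s q := by
  rw [π.marginal_succ]
  symm
  exact Finset.sum_subset (Finset.subset_univ _) fun s _ hs =>
    h.marginal_mul_trans_eq_zero hdom hs hq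

open scoped Classical in
theorem IsAbsorbingOn.sum_marginal_succ (hdom : π.IsDominatedBy πS) (t : ℕ) :
    ∑ q with q ∈ C, π.marginal (t + 1) q = ∑ q with q ∈ C, π.marginal t q +
      ∑ s ∈ diffStates πS C, ∑ q with q ∈ C, π.marginal t s * (π t).trans s q := by
  simp only [π.marginal_succ]
  rw [Finset.sum_comm, ← Finset.sum_filter_add_sum_filter_not Finset.univ (· ∈ C)]
  congr 1
  · refine Finset.sum_congr rfl fun s hs => ?_
    have hs : s ∈ C := (Finset.mem_filter.1 hs).2
    rw [Finset.sum_filter_of_ne fun q _ hne => ?_, ← Finset.mul_sum, (π t).trans_sum, mul_one]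
    by_contra hq
    exact hne (h.marginal_mul_trans_eq_zero_of_mem π hs hq)
  · symm
    refine Finset.sum_subset (fun s hs => ?_) fun s hs hs' => Finset.sum_eq_zero fun q hq => ?_
    · simpa using (mem_diffStates.1 hs).2
    · have hsC : s ∉ C := (Finset.mem_filter.1 hs).2
      have hqC : q ∈ C := (Finset.mem_filter.1 hq).2
      have hcl : s ∈ πS.closedStates := by
        rw [mem_diffStates] at hs'
        tauto
      by_contra hne
      have hm := (π.marginal_nonneg t s).lt_of_ne' (left_ne_zero_of_mul hne)
      have hp := ((π t).trans_nonneg s q).lt_of_ne' (right_ne_zero_of_mul hne)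
      exact (hdom t s q hm hp).ne' (h.trans_eq_zero_of_mem_closedStates
        (h.mem_of_marginal_pos π hm) hsC hcl hqC)

open scoped Classical in
-- Almost surely `C` is never left, so being in `C` at time `n` is the same event, up to a null set,
-- as having visited `C` by time `n`; these events increase to the reachability event.
theorem IsAbsorbingOn.tendsto_reachProb (π : M.Policy) :
    Filter.Tendsto (fun n => ∑ q with q ∈ C, π.marginal n q) Filter.atTop
      (nhds (π.reachProb C)) := by
  have hmeas (t : ℕ) : MeasurableSet {ξ : ℕ → S | ξ t ∈ C} :=
    measurable_pi_apply (X := fun _ : ℕ => S) t (Set.to_countable C).measurableSet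
  have hsum (n : ℕ) : ∑ q with q ∈ C, π.marginal n q = π.pathMeasure.real {ξ | ξ n ∈ C} := by
    have h1 : {ξ : ℕ → S | ξ n ∈ C} =
        ⋃ s ∈ Finset.univ.filter (· ∈ C), {ξ : ℕ → S | ξ n = s} := by
      ext ξ
      simp
    rw [h1, measureReal_biUnion_finset]
    · rfl
    · intro s _ s' _ hs
      exact Set.disjoint_left.2 fun ξ h1 h2 => hs (h1.symm.trans h2)
    · exact fun s _ => measurableSet_coord_eq n s
  have hae : ∀ᵐ ξ ∂π.pathMeasure, ∀ t, ξ t ∈ C → ξ (t + 1) ∈ C := by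
    refine ae_all_iff.2 fun t => ?_
    have h1 : ∀ᵐ ξ ∂π.pathMeasure, ∀ p : S × S, p.1 ∈ C → p.2 ∉ C →
        ¬ (ξ t = p.1 ∧ ξ (t + 1) = p.2) := by
      refine ae_all_iff.2 fun p => ?_
      by_cases hp : p.1 ∈ C ∧ p.2 ∉ C
      · have h2 := π.marginal_pair t p.1 p.2
        rw [h.marginal_mul_trans_eq_zero_of_mem π hp.1 hp.2, measureReal_eq_zero_iff] at h2
        filter_upwards [measure_eq_zero_iff_ae_notMem.1 h2] with ξ hξ _ _
        exact hξ
      · exact Filter.Eventually.of_forall fun ξ h1 h2 => absurd ⟨h1, h2⟩ hp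
    filter_upwards [h1] with ξ hξ h2
    by_contra h3
    exact hξ (ξ t, ξ (t + 1)) h2 h3 ⟨rfl, rfl⟩
  have hmono (n : ℕ) : π.pathMeasure {ξ | ξ n ∈ C} = π.pathMeasure {ξ | ∃ k ≤ n, ξ k ∈ C} := by
    refine measure_congr ?_
    filter_upwards [hae] with ξ hξ
    refine propext ⟨fun h1 => ⟨n, le_rfl, h1⟩, fun ⟨k, hk, h1⟩ => ?_⟩
    exact Nat.le_induction (P := fun m _ => ξ m ∈ C) h1 (fun m _ hm => hξ m hm) n hk
  have hunion : {ξ : ℕ → S | ∃ k, ξ k ∈ C} = ⋃ n, {ξ : ℕ → S | ∃ k ≤ n, ξ k ∈ C} := by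
    ext ξ
    simp only [Set.mem_ofPred_eq, Set.mem_iUnion]
    exact ⟨fun ⟨k, hk⟩ => ⟨k, k, le_rfl, hk⟩, fun ⟨_, k, _, hk⟩ => ⟨k, hk⟩⟩
  have ht := tendsto_measure_iUnion_atTop (μ := π.pathMeasure)
    (s := fun n => {ξ : ℕ → S | ∃ k ≤ n, ξ k ∈ C})
    (fun m n hmn ξ ⟨k, hk, h1⟩ => ⟨k, hk.trans hmn, h1⟩)
  rw [← hunion] at ht
  refine ((ENNReal.tendsto_toReal (measure_ne_top _ _)).comp ht).congr fun n => ?_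
  simp only [hsum, Function.comp, ← hmono]
  rfl

open scoped Classical in
theorem IsAbsorbingOn.hasSum_reachProb (hdom : π.IsDominatedBy πS) :
    HasSum (fun t => ∑ s ∈ diffStates πS C, ∑ q with q ∈ C, π.marginal t s * (π t).trans s q)
      (π.reachProb C - if M.init ∈ C then 1 else 0) := by
  rw [hasSum_iff_tendsto_nat_of_nonneg fun t => Finset.sum_nonneg fun s _ =>
    Finset.sum_nonneg fun q _ => mul_nonneg (π.marginal_nonneg t s) ((π t).trans_nonneg s q)]
  refine ((h.tendsto_reachProb π).sub_const _).congr fun n => ?_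
  induction n with
  | zero => simp [π.marginal_zero, Finset.sum_ite_eq']
  | succ n ih => rw [Finset.sum_range_succ, ← ih, h.sum_marginal_succ hdom]; ring

end Absorbing

/-! ### Residence times -/

section Residence

variable {π : M.Policy} {s : S}

theorem Policy.summable_marginal_mul (hs : Summable fun t => π.marginal t s) {f : ℕ → ℝ}
    (h0 : ∀ t, 0 ≤ f t) (h1 : ∀ t, f t ≤ 1) : Summable fun t => π.marginal t s * f t :=
  hs.of_nonneg_of_le (fun t => mul_nonneg (π.marginal_nonneg t s) (h0 t))
    fun t => mul_le_of_le_one_right (π.marginal_nonneg t s) (h1 t)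

theorem Policy.residenceTime_eq (hs : Summable fun t => π.marginal t s) (a : A) :
    π.residenceTime s a = ENNReal.ofReal (∑' t, π.marginal t s * (π t).act s a) := by
  rw [ENNReal.ofReal_tsum_of_nonneg
    (fun t => mul_nonneg (π.marginal_nonneg t s) ((π t).act_nonneg s a))
    (Policy.summable_marginal_mul hs (fun t => (π t).act_nonneg s a)
      fun t => (π t).act_le_one s a)]
  refine tsum_congr fun t => ?_
  rw [ENNReal.ofReal_mul (π.marginal_nonneg t s), π.ofReal_marginal]

theorem Policy.residenceTime_lt_top (hs : Summable fun t => π.marginal t s) (a : A) :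
    π.residenceTime s a < ⊤ := by
  rw [Policy.residenceTime_eq hs]
  exact ENNReal.ofReal_lt_top

theorem Policy.toReal_residenceTime (hs : Summable fun t => π.marginal t s) (a : A) :
    (π.residenceTime s a).toReal = ∑' t, π.marginal t s * (π t).act s a := by
  rw [Policy.residenceTime_eq hs, ENNReal.toReal_ofReal (tsum_nonneg fun t =>
    mul_nonneg (π.marginal_nonneg t s) ((π t).act_nonneg s a))]

theorem Policy.sum_residenceTime (hs : Summable fun t => π.marginal t s) :
    ∑ a : M.avail s, (π.residenceTime s a).toReal = ∑' t, π.marginal t s := by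
  simp only [Policy.toReal_residenceTime hs]
  refine (Summable.tsum_finsetSum fun (a : M.avail s) _ => Policy.summable_marginal_mul hs
    (fun t => (π t).act_nonneg s a) fun t => (π t).act_le_one s a).symm.trans ?_
  refine tsum_congr fun t => ?_
  rw [← Finset.mul_sum, Finset.sum_coe_sort (M.avail s) fun a => (π t).act s a, (π t).act_sum,
    mul_one]

theorem Policy.sum_residenceTime_mul_prob (hs : Summable fun t => π.marginal t s) (q : S) :
    ∑ a : M.avail s, (π.residenceTime s a).toReal * M.prob s a q =
      ∑' t, π.marginal t s * (π t).trans s q := by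
  simp only [Policy.toReal_residenceTime hs, ← tsum_mul_right]
  refine (Summable.tsum_finsetSum fun (a : M.avail s) _ => (Policy.summable_marginal_mul hs
    (fun t => (π t).act_nonneg s a) fun t => (π t).act_le_one s a).mul_right _).symm.trans ?_
  refine tsum_congr fun t => ?_
  rw [Finset.sum_coe_sort (M.avail s) fun a => π.marginal t s * (π t).act s a * M.prob s a q,
    StationaryPolicy.trans, Finset.mul_sum]
  exact Finset.sum_congr rfl fun a _ => by ring

end Residence

end MDP

/-! ### Sums of extended reals -/

theorem EReal.coe_finsetSum {ι : Type*} (s : Finset ι) (f : ι → ℝ) :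
    ((∑ i ∈ s, f i : ℝ) : EReal) = ∑ i ∈ s, (f i : EReal) := by
  classical
  induction s using Finset.induction_on with
  | empty => simp
  | insert i s hi ih => rw [Finset.sum_insert hi, Finset.sum_insert hi, EReal.coe_add, ih]

theorem EReal.coe_ennreal_finsetSum {ι : Type*} (s : Finset ι) (f : ι → ℝ≥0∞) :
    ((∑ i ∈ s, f i : ℝ≥0∞) : EReal) = ∑ i ∈ s, (f i : EReal) := by
  classical
  induction s using Finset.induction_on with
  | empty => simp
  | insert i s hi ih => rw [Finset.sum_insert hi, Finset.sum_insert hi, EReal.coe_ennreal_add, ih]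

theorem EReal.finsetSum_ne_bot {ι : Type*} {s : Finset ι} {f : ι → EReal}
    (h : ∀ i ∈ s, f i ≠ ⊥) : ∑ i ∈ s, f i ≠ ⊥ :=
  Finset.sum_induction f (· ≠ ⊥) (fun a b ha hb => by simp [EReal.add_eq_bot_iff, ha, hb])
    (by simp) h

theorem EReal.finsetSum_eq_top {ι : Type*} {s : Finset ι} {f : ι → EReal}
    (h : ∀ i ∈ s, f i ≠ ⊥) {i : ι} (hi : i ∈ s) (htop : f i = ⊤) : ∑ i ∈ s, f i = ⊤ := by
  classical
  rw [← Finset.add_sum_erase s f hi, htop]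
  exact EReal.top_add_of_ne_bot
    (EReal.finsetSum_ne_bot fun j hj => h j (Finset.mem_of_mem_erase hj))

theorem EReal.coe_ennreal_le_coe_iff_ofReal {k : ℝ≥0∞} {r : ℝ} :
    (k : EReal) ≤ (r : EReal) ↔ 0 ≤ r ∧ k ≤ ENNReal.ofReal r := by
  constructor
  · intro h
    have h0 : 0 ≤ r := EReal.coe_nonneg.1 ((EReal.coe_ennreal_nonneg k).trans h)
    refine ⟨h0, ?_⟩
    rwa [← EReal.coe_ennreal_le_coe_ennreal_iff, EReal.coe_ennreal_ofReal, max_eq_left h0]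
  · rintro ⟨h0, h⟩
    rwa [← EReal.coe_ennreal_le_coe_ennreal_iff, EReal.coe_ennreal_ofReal, max_eq_left h0] at h

theorem relEnt_formula_nonneg {p b : ℝ} (hp : 0 ≤ p) (hb : 0 ≤ b) (h : b = 0 → p = 0) :
    0 ≤ p * Real.log (p / b) + b - p := by
  rcases hp.eq_or_lt with rfl | hp
  · simpa using hb
  · have hb' : 0 < b := hb.lt_of_ne' fun h0 => hp.ne' (h h0)
    have h1 := mul_le_mul_of_nonneg_left
      (Real.one_sub_inv_le_log_of_pos (div_pos hp hb')) hp.le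
    have h2 : p * (1 - (p / b)⁻¹) = p - b := by field_simp
    linarith

/-! ### The residence-time program: relative-entropy form, convexity, existence of a minimiser -/

namespace MDP

variable {S A AP : Type*} [Fintype S] {M : MDP S A AP}

theorem logTerm_ne_bot (c p b : ℝ) : logTerm c p b ≠ ⊥ := by
  unfold logTerm
  split_ifs
  · exact EReal.zero_ne_bot
  · exact top_ne_bot
  · exact EReal.coe_ne_bot _

theorem prob_eq_zero_of_notMem_Succ {s q : S} (hq : q ∉ M.Succ s) {a : A} (ha : a ∈ M.avail s) :
    M.prob s a q = 0 := by
  by_contra h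
  exact hq ⟨a, ha, (M.prob_nonneg s a q).lt_of_ne' h⟩

theorem sum_sum_mul_prob (s : S) (x : M.avail s → ℝ) :
    ∑ q, ∑ a : M.avail s, x a * M.prob s a q = ∑ a, x a := by
  rw [Finset.sum_comm]
  exact Finset.sum_congr rfl fun a _ => by rw [← Finset.mul_sum, M.prob_sum s a a.2, mul_one]

open scoped Classical in
-- The logarithm does not depend on the action, so summing over actions leaves `p log (p / b)`. The
-- corrections `b - p` cancel over `q`, as both families sum to the total residence time. If some
-- `b` vanishes where `p` does not, both sides are infinite.
theorem sum_logTerm_eq (πS : M.StationaryPolicy) (s : S) {x : M.avail s → ℝ} (hx : ∀ a, 0 ≤ x a) :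
    ∑ a : M.avail s, ∑ q with q ∈ M.Succ s, logTerm (x a * M.prob s a q)
      (∑ a' : M.avail s, x a' * M.prob s a' q) (πS.trans s q * ∑ a' : M.avail s, x a') =
    ((∑ q, relEnt (∑ a' : M.avail s, x a' * M.prob s a' q)
      (πS.trans s q * ∑ a' : M.avail s, x a') : ℝ≥0∞) : EReal) := by
  set p : S → ℝ := fun q => ∑ a' : M.avail s, x a' * M.prob s a' q with hp
  set b : S → ℝ := fun q => πS.trans s q * ∑ a' : M.avail s, x a' with hb
  change ∑ a : M.avail s, ∑ q with q ∈ M.Succ s, logTerm (x a * M.prob s a q) (p q) (b q) =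
    ((∑ q, relEnt (p q) (b q) : ℝ≥0∞) : EReal)
  have hc0 (q : S) (a : M.avail s) : 0 ≤ x a * M.prob s a q :=
    mul_nonneg (hx a) (M.prob_nonneg s a q)
  have hp0 (q : S) : 0 ≤ p q := Finset.sum_nonneg fun a _ => hc0 q a
  have hb0 (q : S) : 0 ≤ b q :=
    mul_nonneg (πS.trans_nonneg s q) (Finset.sum_nonneg fun a _ => hx a)
  by_cases hac : ∀ q, b q = 0 → p q = 0
  · have hterm (a : M.avail s) (q : S) : logTerm (x a * M.prob s a q) (p q) (b q) =
        ((x a * M.prob s a q * Real.log (p q / b q) : ℝ) : EReal) := by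
      unfold logTerm
      split_ifs with h1 h2
      · simp [h1]
      · exact absurd (le_antisymm ((Finset.single_le_sum (fun a _ => hc0 q a)
          (Finset.mem_univ a)).trans (hac q h2).le) (hc0 q a)) h1
      · rfl
    simp only [hterm]
    rw [Finset.sum_comm]
    simp only [← EReal.coe_finsetSum, ← Finset.sum_mul]
    rw [Finset.sum_congr rfl fun q _ => relEnt_eq (hp0 q) (hb0 q) (hac q),
      ← ENNReal.ofReal_sum_of_nonneg fun q _ => relEnt_formula_nonneg (hp0 q) (hb0 q) (hac q),
      EReal.coe_ennreal_ofReal, max_eq_left (Finset.sum_nonneg fun q _ =>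
        relEnt_formula_nonneg (hp0 q) (hb0 q) (hac q))]
    have hpb : ∑ q, b q = ∑ q, p q := by
      rw [sum_sum_mul_prob, ← Finset.sum_mul, πS.trans_sum, one_mul]
    rw [Finset.sum_sub_distrib, Finset.sum_add_distrib, hpb, add_sub_cancel_right]
    congr 1
    refine Finset.sum_subset (Finset.filter_subset _ _) fun q _ hq => ?_
    have hq : q ∉ M.Succ s := by simpa using hq
    rw [Finset.sum_eq_zero fun a _ => ?_, zero_mul]
    rw [prob_eq_zero_of_notMem_Succ hq a.2, mul_zero]
  · push Not at hac
    obtain ⟨q, hbq, hpq⟩ := hac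
    have h1 : ∑ q, relEnt (p q) (b q) = ⊤ := by
      refine ENNReal.sum_eq_top.2 ⟨q, Finset.mem_univ q, ?_⟩
      rw [hbq]
      exact relEnt_zero_right ((hp0 q).lt_of_ne' hpq)
    obtain ⟨a, -, ha⟩ := Finset.exists_ne_zero_of_sum_ne_zero hpq
    rw [h1, EReal.coe_ennreal_top]
    have hq : q ∈ M.Succ s :=
      ⟨a, a.2, (M.prob_nonneg s a q).lt_of_ne' (right_ne_zero_of_mul ha)⟩
    refine EReal.finsetSum_eq_top (fun a _ => EReal.finsetSum_ne_bot fun q _ =>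
      logTerm_ne_bot _ _ _) (Finset.mem_univ a) ?_
    refine EReal.finsetSum_eq_top (fun q _ => logTerm_ne_bot _ _ _)
      (Finset.mem_filter.2 ⟨Finset.mem_univ q, hq⟩) ?_
    simp [logTerm, ha, hbq]

section Program

variable (πS : M.StationaryPolicy) (C : Set S)

/-- The total residence time at a state. -/
noncomputable def residenceTotal (s : diffStates πS C) : ResidenceVar πS C →ₗ[ℝ] ℝ where
  toFun x := ∑ a : M.avail s, x s a
  map_add' x y := by simp [Finset.sum_add_distrib]
  map_smul' c x := by simp [Finset.mul_sum]

/-- The expected number of transitions between two states. -/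
noncomputable def residenceFlow (s : diffStates πS C) (q : S) : ResidenceVar πS C →ₗ[ℝ] ℝ where
  toFun x := ∑ a : M.avail s, x s a * M.prob s a q
  map_add' x y := by simp [Finset.sum_add_distrib, add_mul]
  map_smul' c x := by simp [Finset.mul_sum, mul_assoc]

/-- The objective of the residence-time program as a sum of relative entropies. -/
noncomputable def residenceDiv (x : ResidenceVar πS C) : ℝ≥0∞ :=
  ∑ s : diffStates πS C, ∑ q, relEnt (residenceFlow πS C s q x)
    (πS.trans s q * residenceTotal πS C s x)

variable {πS C}

theorem residenceTotal_nonneg {x : ResidenceVar πS C} (hx : ∀ s a, 0 ≤ x s a)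
    (s : diffStates πS C) : 0 ≤ residenceTotal πS C s x :=
  Finset.sum_nonneg fun a _ => hx s a

theorem residenceFlow_nonneg {x : ResidenceVar πS C} (hx : ∀ s a, 0 ≤ x s a)
    (s : diffStates πS C) (q : S) : 0 ≤ residenceFlow πS C s q x :=
  Finset.sum_nonneg fun a _ => mul_nonneg (hx s a) (M.prob_nonneg s a q)

theorem sum_residenceFlow (x : ResidenceVar πS C) (s : diffStates πS C) :
    ∑ q, residenceFlow πS C s q x = residenceTotal πS C s x :=
  sum_sum_mul_prob (s : S) (x s)

theorem residenceProgram_objective_eq {ν : ℝ} {x : ResidenceVar πS C} (hx : ∀ s a, 0 ≤ x s a) :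
    (residenceProgram πS C ν).objective x = (residenceDiv πS C x : EReal) := by
  unfold residenceDiv
  rw [EReal.coe_ennreal_finsetSum]
  exact Finset.sum_congr rfl fun s _ => sum_logTerm_eq πS s (hx s)

open scoped Classical in
theorem mem_residenceProgram_feasible {ν : ℝ} {x : ResidenceVar πS C} :
    x ∈ (residenceProgram πS C ν).feasible ↔
      (∀ s a, 0 ≤ x s a) ∧
      ν ≤ ∑ q with q ∈ C, (∑ s, residenceFlow πS C s q x + if q = M.init then 1 else 0) ∧
      ∀ s : diffStates πS C, residenceTotal πS C s x =
        ∑ q, residenceFlow πS C q s x + if (s : S) = M.init then 1 else 0 := by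
  constructor
  · rintro ⟨hx, h1, h2⟩
    refine ⟨hx, sub_nonpos.1 (h1 (Sum.inr ())), fun s => ?_⟩
    have h3 := h2 s
    simp only [residenceProgram] at h3
    change residenceTotal πS C s x - ∑ q, residenceFlow πS C q s x - _ = 0 at h3
    linarith
  · rintro ⟨hx, h1, h2⟩
    refine ⟨hx, ?_, fun s => ?_⟩
    · rintro (⟨s, a⟩ | u)
      · exact neg_nonpos.2 (hx s a)
      · exact sub_nonpos.2 h1
    · change residenceTotal πS C s x - ∑ q, residenceFlow πS C q s x - _ = 0
      rw [h2 s]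
      ring

theorem residenceDiv_convex_comb_le (x y : ResidenceVar πS C) {a b : ℝ} (ha : 0 ≤ a)
    (hb : 0 ≤ b) : residenceDiv πS C (a • x + b • y) ≤
      ENNReal.ofReal a * residenceDiv πS C x + ENNReal.ofReal b * residenceDiv πS C y := by
  unfold residenceDiv
  simp only [Finset.mul_sum, ← Finset.sum_add_distrib]
  refine Finset.sum_le_sum fun s _ => Finset.sum_le_sum fun q _ => ?_
  rw [← relEnt_mul ha, ← relEnt_mul hb]
  refine le_trans (le_of_eq ?_) (relEnt_add_le _ _ _ _)
  simp only [map_add, map_smul, smul_eq_mul]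
  ring_nf

theorem residenceProgram_isConvex (ν : ℝ) : (residenceProgram πS C ν).IsConvex := by
  classical
  have hdom : Convex ℝ (residenceProgram πS C ν).domain := by
    intro x hx y hy a b ha hb _ s t
    exact add_nonneg (mul_nonneg ha (hx s t)) (mul_nonneg hb (hy s t))
  refine ⟨hdom, fun x hx => ?_, ?_, ?_, fun s => ?_⟩
  · rw [residenceProgram_objective_eq hx]
    exact EReal.coe_ennreal_ne_bot _
  · rintro ⟨x, r⟩ ⟨hx, hxr⟩ ⟨y, r'⟩ ⟨hy, hyr⟩ a b ha hb hab
    have hz := hdom hx hy ha hb hab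
    refine ⟨hz, ?_⟩
    change (residenceProgram πS C ν).objective (a • x + b • y) ≤ ((a * r + b * r' : ℝ) : EReal)
    rw [residenceProgram_objective_eq hz, EReal.coe_ennreal_le_coe_iff_ofReal]
    rw [residenceProgram_objective_eq hx, EReal.coe_ennreal_le_coe_iff_ofReal] at hxr
    rw [residenceProgram_objective_eq hy, EReal.coe_ennreal_le_coe_iff_ofReal] at hyr
    obtain ⟨hr, hxr⟩ := hxr
    obtain ⟨hr', hyr⟩ := hyr
    simp only at hr hr' hxr hyr
    refine ⟨by positivity, (residenceDiv_convex_comb_le x y ha hb).trans ?_⟩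
    rw [ENNReal.ofReal_add (by positivity) (by positivity), ENNReal.ofReal_mul ha,
      ENNReal.ofReal_mul hb]
    gcongr
  · rintro (⟨s, a⟩ | u)
    · refine ⟨hdom, fun x _ y _ c d _ _ _ => le_of_eq ?_⟩
      simp only [residenceProgram, Pi.add_apply, Pi.smul_apply, smul_eq_mul]
      ring
    · have h1 := (((-∑ q with q ∈ C, ∑ s, residenceFlow πS C s q).convexOn hdom).add_const
        (ν - ∑ q with q ∈ C, if q = M.init then 1 else 0))
      refine h1.congr fun x _ => ?_
      change _ = ν - ∑ q with q ∈ C,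
        (∑ s, residenceFlow πS C s q x + if q = M.init then 1 else 0)
      simp only [Finset.sum_add_distrib, LinearMap.neg_apply, LinearMap.sum_apply, Pi.add_apply]
      ring
  · refine ⟨(residenceTotal πS C s - ∑ q, residenceFlow πS C q s).toAffineMap +
      AffineMap.const ℝ _ (-if (s : S) = M.init then 1 else 0), fun x => ?_⟩
    change residenceTotal πS C s x - ∑ q, residenceFlow πS C q s x -
      (if (s : S) = M.init then 1 else 0) = _
    simp only [AffineMap.coe_add, LinearMap.coe_toAffineMap, AffineMap.coe_const, Pi.add_apply,
      LinearMap.sub_apply, LinearMap.sum_apply, Function.const_apply]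
    ring

/-- The argument of `Policy.summable_marginal` with the flow equations in place of telescoping in
time; it is what makes sublevel sets bounded. -/
theorem exists_sum_residenceTotal_le (πS : M.StationaryPolicy) (C : Set S) (ν : ℝ) {K : ℝ≥0∞}
    (hK : K ≠ ⊤) : ∃ B : ℝ, ∀ x ∈ (residenceProgram πS C ν).feasible, residenceDiv πS C x ≤ K →
      ∑ s, residenceTotal πS C s x ≤ B := by
  classical
  obtain ⟨v, ε, hv, hε, hpot⟩ := πS.exists_potential
  refine ⟨(K.toReal + v M.init) / ε, fun x hx hxK => ?_⟩
  obtain ⟨hx0, -, hflow⟩ := mem_residenceProgram_feasible.1 hx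
  have h1 : ∑ s : diffStates πS C, (∑ q, residenceFlow πS C s q x * v q +
      residenceTotal πS C s x * (ε - v s)) ≤ K.toReal := by
    refine (ENNReal.ofReal_le_iff_le_toReal hK).1 (le_trans ?_ hxK)
    refine (ENNReal.ofReal_finsetSum_le _ _).trans (Finset.sum_le_sum fun s _ => ?_)
    have hs := (mem_diffStates.1 s.2).1
    have h2 := hpot s
    rw [if_neg hs] at h2
    exact ofReal_potential_le_sum_relEnt πS v ε s h2 (residenceTotal_nonneg hx0 s) _
      (sum_residenceFlow x s)
  -- The flow that leaves `diffStates` can be dropped because `v` is nonnegative.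
  have h2 : ∑ q : diffStates πS C, (∑ s, residenceFlow πS C s q x) * v q ≤
      ∑ s : diffStates πS C, ∑ q, residenceFlow πS C s q x * v q := by
    rw [Finset.sum_comm]
    simp only [← Finset.sum_mul]
    rw [Finset.sum_coe_sort (diffStates πS C) fun q => (∑ s, residenceFlow πS C s q x) * v q]
    exact Finset.sum_le_sum_of_subset_of_nonneg (Finset.subset_univ _) fun q _ _ =>
      mul_nonneg (Finset.sum_nonneg fun s _ => residenceFlow_nonneg hx0 s q) (hv q)
  have h3 : ∑ q : diffStates πS C, (∑ s, residenceFlow πS C s q x) * v q =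
      ∑ q, residenceTotal πS C q x * v q -
        ∑ q : diffStates πS C, (if (q : S) = M.init then 1 else 0) * v q := by
    rw [← Finset.sum_sub_distrib]
    refine Finset.sum_congr rfl fun q _ => ?_
    rw [hflow q]
    ring
  have h4 : ∑ q : diffStates πS C, (if (q : S) = M.init then 1 else 0) * v q ≤ v M.init := by
    rw [Finset.sum_coe_sort (diffStates πS C) fun q => (if q = M.init then 1 else 0) * v q]
    refine (Finset.sum_le_sum_of_subset_of_nonneg (Finset.subset_univ _) fun q _ _ => ?_).trans
      (le_of_eq (by simp))
    exact mul_nonneg (by split_ifs <;> norm_num) (hv q)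
  rw [Finset.sum_add_distrib] at h1
  simp only [mul_sub, Finset.sum_sub_distrib, ← Finset.sum_mul] at h1
  rw [le_div_iff₀ hε]
  linarith

theorem lowerSemicontinuous_residenceDiv : LowerSemicontinuous (residenceDiv πS C) := by
  have hcont (f : ResidenceVar πS C →ₗ[ℝ] ℝ) : Continuous f := f.continuous_of_finiteDimensional
  refine lowerSemicontinuous_sum fun s _ => lowerSemicontinuous_sum fun q _ => ?_
  exact lowerSemicontinuous_relEnt (hcont _) ((hcont _).const_mul _)

theorem isClosed_residenceProgram_feasible (ν : ℝ) :
    IsClosed (residenceProgram πS C ν).feasible := by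
  classical
  have hcont (f : ResidenceVar πS C →ₗ[ℝ] ℝ) : Continuous f := f.continuous_of_finiteDimensional
  have h : (residenceProgram πS C ν).feasible = {x | ∀ s a, 0 ≤ x s a} ∩
      ({x | ν ≤ ∑ q with q ∈ C,
        (∑ s, residenceFlow πS C s q x + if q = M.init then 1 else 0)} ∩
      {x | ∀ s : diffStates πS C, residenceTotal πS C s x =
        ∑ q, residenceFlow πS C q s x + if (s : S) = M.init then 1 else 0}) := by
    ext x
    exact mem_residenceProgram_feasible
  rw [h]
  refine IsClosed.inter ?_ (IsClosed.inter ?_ ?_)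
  · simp only [Set.ofPred_forall]
    exact isClosed_iInter fun s => isClosed_iInter fun a =>
      isClosed_le continuous_const (by fun_prop)
  · exact isClosed_le continuous_const (continuous_finsetSum _ fun q _ =>
      (continuous_finsetSum _ fun s _ => hcont _).add continuous_const)
  · simp only [Set.ofPred_forall]
    exact isClosed_iInter fun s => isClosed_eq (hcont _)
      ((continuous_finsetSum _ fun q _ => hcont _).add continuous_const)

theorem exists_isMinOn_residenceDiv {ν : ℝ} {x₀ : ResidenceVar πS C}
    (hx₀ : x₀ ∈ (residenceProgram πS C ν).feasible) (hfin : residenceDiv πS C x₀ ≠ ⊤) :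
    ∃ x ∈ (residenceProgram πS C ν).feasible,
      ∀ y ∈ (residenceProgram πS C ν).feasible, residenceDiv πS C x ≤ residenceDiv πS C y := by
  have hcont (f : ResidenceVar πS C →ₗ[ℝ] ℝ) : Continuous f := f.continuous_of_finiteDimensional
  obtain ⟨B, hB⟩ := exists_sum_residenceTotal_le πS C ν hfin
  let K := (residenceProgram πS C ν).feasible ∩ {x | ∑ s, residenceTotal πS C s x ≤ B}
  have hK : IsCompact K := by
    refine IsCompact.of_isClosed_subset
      (isCompact_Icc (a := (0 : ResidenceVar πS C)) (b := fun _ _ => B))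
      ((isClosed_residenceProgram_feasible ν).inter (isClosed_le
        (continuous_finsetSum _ fun s _ => hcont _) continuous_const)) fun x hx => ?_
    have hx0 : ∀ s a, 0 ≤ x s a := hx.1.1
    refine ⟨fun s a => hx0 s a, fun s a => le_trans ?_ hx.2⟩
    have h1 : x s a ≤ residenceTotal πS C s x :=
      Finset.single_le_sum (f := x s) (fun a _ => hx0 s a) (Finset.mem_univ a)
    exact h1.trans (Finset.single_le_sum (f := fun s => residenceTotal πS C s x)
      (fun s _ => residenceTotal_nonneg hx0 s) (Finset.mem_univ s))
  have hx₀K : x₀ ∈ K := ⟨hx₀, hB x₀ hx₀ le_rfl⟩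
  obtain ⟨x, hxK, hmin⟩ := LowerSemicontinuousOn.exists_isMinOn ⟨x₀, hx₀K⟩ hK
    (lowerSemicontinuous_residenceDiv.lowerSemicontinuousOn K)
  refine ⟨x, hxK.1, fun y hy => ?_⟩
  -- Feasible points outside the compact set have a larger objective than `x₀`, which belongs to it.
  rcases le_total (residenceDiv πS C y) (residenceDiv πS C x₀) with h | h
  · exact hmin ⟨hy, hB y hy h⟩
  · exact (hmin hx₀K).trans h

end Program

end MDP

namespace MDP

variable {S A AP : Type*} [Fintype S] {M : MDP S A AP}
  [MeasurableSpace S] [MeasurableSingletonClass S] {πS : M.StationaryPolicy} {C : Set S}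

/-! ### From policies to residence times -/

theorem residenceTotal_residenceVector {π : M.Policy} {s : diffStates πS C}
    (hs : Summable fun t => π.marginal t s) :
    residenceTotal πS C s (residenceVector πS C π) = ∑' t, π.marginal t s :=
  Policy.sum_residenceTime hs

theorem residenceFlow_residenceVector {π : M.Policy} {s : diffStates πS C}
    (hs : Summable fun t => π.marginal t s) (q : S) :
    residenceFlow πS C s q (residenceVector πS C π) = ∑' t, π.marginal t s * (π t).trans s q :=
  Policy.sum_residenceTime_mul_prob hs q

theorem Policy.summable_marginal_mul_trans {π : M.Policy} {s : S}
    (hs : Summable fun t => π.marginal t s) (q : S) :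
    Summable fun t => π.marginal t s * (π t).trans s q :=
  Policy.summable_marginal_mul hs (fun t => (π t).trans_nonneg s q)
    fun t => (π t).trans_le_one s q

open scoped Classical in
theorem IsAbsorbingOn.tsum_marginal_eq {R : Set S} (h : M.IsAbsorbingOn R C) {π : M.Policy}
    (hdom : π.IsDominatedBy πS) (hsum : ∀ s ∈ diffStates πS C, Summable fun t => π.marginal t s)
    {s : S} (hs : s ∈ diffStates πS C) :
    ∑' t, π.marginal t s =
      ∑ q ∈ diffStates πS C, ∑' t, π.marginal t q * (π t).trans q s +
        if s = M.init then 1 else 0 := by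
  rw [(hsum s hs).tsum_eq_zero_add, π.marginal_zero, add_comm]
  congr 1
  rw [← Summable.tsum_finsetSum fun q hq => Policy.summable_marginal_mul_trans (hsum q hq) s]
  exact tsum_congr fun t => h.marginal_succ hdom t hs

open scoped Classical in
theorem IsAbsorbingOn.reachProb_eq {R : Set S} (h : M.IsAbsorbingOn R C) {π : M.Policy}
    (hdom : π.IsDominatedBy πS)
    (hsum : ∀ s ∈ diffStates πS C, Summable fun t => π.marginal t s) :
    π.reachProb C = ∑ q with q ∈ C, (∑ s ∈ diffStates πS C,
      ∑' t, π.marginal t s * (π t).trans s q + if q = M.init then 1 else 0) := by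
  have h1 := (h.hasSum_reachProb hdom).tsum_eq
  rw [Summable.tsum_finsetSum fun s hs => summable_sum fun q _ =>
    Policy.summable_marginal_mul_trans (hsum s hs) q] at h1
  rw [Finset.sum_congr rfl fun s hs => Summable.tsum_finsetSum fun q _ =>
    Policy.summable_marginal_mul_trans (hsum s hs) q, Finset.sum_comm] at h1
  rw [Finset.sum_add_distrib, h1]
  simp [Finset.sum_ite_eq']

theorem IsAbsorbingOn.residenceVector_mem_feasible {R : Set S} (h : M.IsAbsorbingOn R C)
    {π : M.Policy} (hfin : pathKL π πS ≠ ⊤) {ν : ℝ} (hν : ν ≤ π.reachProb C) :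
    residenceVector πS C π ∈ (residenceProgram πS C ν).feasible := by
  classical
  have hsum (s : S) (hs : s ∈ diffStates πS C) : Summable fun t => π.marginal t s :=
    Policy.summable_marginal hfin (mem_diffStates.1 hs).1
  have hdom := Policy.isDominatedBy_of_pathKL_ne_top hfin
  refine mem_residenceProgram_feasible.2 ⟨fun s a => ENNReal.toReal_nonneg, ?_, fun s => ?_⟩
  · rw [h.reachProb_eq hdom hsum] at hν
    refine hν.trans (le_of_eq (Finset.sum_congr rfl fun q _ => ?_))
    rw [← Finset.sum_coe_sort (diffStates πS C)]
    congr 1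
    exact Finset.sum_congr rfl fun s _ => (residenceFlow_residenceVector (hsum s s.2) q).symm
  · rw [residenceTotal_residenceVector (hsum s s.2), h.tsum_marginal_eq hdom hsum s.2,
      ← Finset.sum_coe_sort (diffStates πS C)]
    congr 1
    exact Finset.sum_congr rfl fun q _ => (residenceFlow_residenceVector (hsum q q.2) s).symm

/-- Averaging the decision rules over time lowers the divergence, by subadditivity of `relEnt`; the
cost incurred outside `diffStates` is discarded. -/
theorem residenceDiv_residenceVector_le {π : M.Policy} (hfin : pathKL π πS ≠ ⊤) :
    residenceDiv πS C (residenceVector πS C π) ≤ pathKL π πS := by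
  have hsum (s : S) (hs : s ∈ diffStates πS C) : Summable fun t => π.marginal t s :=
    Policy.summable_marginal hfin (mem_diffStates.1 hs).1
  calc residenceDiv πS C (residenceVector πS C π)
      ≤ ∑ s : diffStates πS C, ∑' t, ENNReal.ofReal (π.marginal t s) * (π t).divAt πS s := by
        refine Finset.sum_le_sum fun s _ => ?_
        simp only [StationaryPolicy.divAt, Finset.mul_sum]
        rw [Summable.tsum_finsetSum fun _ _ => ENNReal.summable]
        refine Finset.sum_le_sum fun q _ => ?_
        rw [residenceFlow_residenceVector (hsum s s.2),
          residenceTotal_residenceVector (hsum s s.2), ← tsum_mul_left]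
        refine (relEnt_tsum_le (Policy.summable_marginal_mul_trans (hsum s s.2) q)
          ((hsum s s.2).mul_left _)).trans (ENNReal.tsum_le_tsum fun t => le_of_eq ?_)
        rw [← relEnt_mul (π.marginal_nonneg t s), mul_comm (πS.trans s q)]
    _ ≤ ∑' t, ∑ s, ENNReal.ofReal (π.marginal t s) * (π t).divAt πS s := by
        rw [← Summable.tsum_finsetSum fun _ _ => ENNReal.summable]
        refine ENNReal.tsum_le_tsum fun t => ?_
        rw [Finset.sum_coe_sort (diffStates πS C) fun s =>
          ENNReal.ofReal (π.marginal t s) * (π t).divAt πS s]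
        exact Finset.sum_le_sum_of_subset (Finset.subset_univ _)
    _ = pathKL π πS := (pathKL_eq_tsum π πS).symm

/-! ### From residence times to stationary policies -/

theorem StationaryPolicy.act_le_one_of_sum {μ : A → ℝ} {F : Finset A} (h0 : ∀ a, 0 ≤ μ a)
    (h1 : ∑ a ∈ F, μ a = 1) (hF : ∀ a ∉ F, μ a ≤ 1) (a : A) : μ a ≤ 1 := by
  by_cases ha : a ∈ F
  · rw [← h1]
    exact Finset.single_le_sum (fun a _ => h0 a) ha
  · exact hF a ha

open scoped Classical in
/-- The action probabilities proportional to given residence times, and those of the reference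
policy where the residence time is zero or the agent does not deviate. -/
noncomputable def residenceAct (x : ResidenceVar πS C) (s : S) (a : A) : ℝ :=
  if h : ∃ hs : s ∈ diffStates πS C, 0 < residenceTotal πS C ⟨s, hs⟩ x then
    if ha : a ∈ M.avail s then x ⟨s, h.1⟩ ⟨a, ha⟩ / residenceTotal πS C ⟨s, h.1⟩ x else 0
  else πS.act s a

omit [MeasurableSpace S] [MeasurableSingletonClass S] in
theorem sum_residenceAct (x : ResidenceVar πS C) (s : S) :
    ∑ a ∈ M.avail s, residenceAct x s a = 1 := by
  classical
  by_cases h : ∃ hs : s ∈ diffStates πS C, 0 < residenceTotal πS C ⟨s, hs⟩ x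
  · rw [← Finset.sum_coe_sort]
    simp only [residenceAct, h, dif_pos, Finset.coe_mem, Subtype.coe_eta]
    rw [← Finset.sum_div]
    exact div_self h.2.ne'
  · simp only [residenceAct, h, dif_neg, not_false_eq_true]
    exact πS.act_sum s

omit [MeasurableSpace S] [MeasurableSingletonClass S] in
theorem residenceAct_nonneg {x : ResidenceVar πS C} (hx : ∀ s a, 0 ≤ x s a) (s : S) (a : A) :
    0 ≤ residenceAct x s a := by
  unfold residenceAct
  split_ifs with h ha
  · exact div_nonneg (hx _ _) h.2.le
  · exact le_rfl
  · exact πS.act_nonneg s a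

/-- The stationary policy with given residence times. -/
noncomputable def residencePolicy (x : ResidenceVar πS C) (hx : ∀ s a, 0 ≤ x s a) :
    M.StationaryPolicy where
  act := residenceAct x
  act_nonneg := residenceAct_nonneg hx
  act_le_one s := StationaryPolicy.act_le_one_of_sum (residenceAct_nonneg hx s)
    (sum_residenceAct x s) fun a ha => by
      unfold residenceAct
      split_ifs
      · exact zero_le_one
      · exact πS.act_le_one s a
  act_sum := sum_residenceAct x

section ResidencePolicy

variable {x : ResidenceVar πS C} (hx : ∀ s a, 0 ≤ x s a)

omit [MeasurableSpace S] [MeasurableSingletonClass S] in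
theorem residencePolicy_trans_of_not {s : S}
    (h : ¬ ∃ hs : s ∈ diffStates πS C, 0 < residenceTotal πS C ⟨s, hs⟩ x) (q : S) :
    (residencePolicy x hx).trans s q = πS.trans s q := by
  simp only [StationaryPolicy.trans, residencePolicy, residenceAct, h, dif_neg, not_false_eq_true]

omit [MeasurableSpace S] [MeasurableSingletonClass S] in
theorem residenceTotal_mul_trans (s : diffStates πS C) (q : S) :
    residenceTotal πS C s x * (residencePolicy x hx).trans s q = residenceFlow πS C s q x := by
  classical
  rcases (residenceTotal_nonneg hx s).eq_or_lt with h0 | h0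
  · rw [← h0, zero_mul]
    symm
    refine Finset.sum_eq_zero fun a _ => ?_
    rw [(Finset.sum_eq_zero_iff_of_nonneg fun a _ => hx s a).1 h0.symm a (Finset.mem_univ a),
      zero_mul]
  · have h : ∃ hs : (s : S) ∈ diffStates πS C, 0 < residenceTotal πS C ⟨s, hs⟩ x := ⟨s.2, h0⟩
    simp only [StationaryPolicy.trans, residencePolicy]
    rw [← Finset.sum_coe_sort, Finset.mul_sum]
    refine Finset.sum_congr rfl fun a _ => ?_
    have hact : residenceAct x s a = x s a / residenceTotal πS C s x := by
      rw [residenceAct, dif_pos h, dif_pos a.2]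
    rw [hact]
    field_simp

omit [MeasurableSpace S] [MeasurableSingletonClass S] in
theorem residenceDiv_eq_sum_divAt : residenceDiv πS C x =
    ∑ s : diffStates πS C, ENNReal.ofReal (residenceTotal πS C s x) *
      (residencePolicy x hx).divAt πS s := by
  refine Finset.sum_congr rfl fun s _ => ?_
  rw [StationaryPolicy.divAt, Finset.mul_sum]
  refine Finset.sum_congr rfl fun q _ => ?_
  rw [← relEnt_mul (residenceTotal_nonneg hx s), residenceTotal_mul_trans,
    mul_comm (πS.trans s q)]

omit [MeasurableSpace S] [MeasurableSingletonClass S] in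
theorem residencePolicy_trans_pos (hfin : residenceDiv πS C x ≠ ⊤) {s q : S}
    (h : 0 < (residencePolicy x hx).trans s q) : 0 < πS.trans s q := by
  by_cases hs : ∃ hs : s ∈ diffStates πS C, 0 < residenceTotal πS C ⟨s, hs⟩ x
  · obtain ⟨hs, hpos⟩ := hs
    refine (πS.trans_nonneg s q).lt_of_ne' fun h0 => hfin ?_
    refine ENNReal.sum_eq_top.2 ⟨⟨s, hs⟩, Finset.mem_univ _, ENNReal.sum_eq_top.2
      ⟨q, Finset.mem_univ q, ?_⟩⟩
    rw [h0, zero_mul, ← residenceTotal_mul_trans hx]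
    exact relEnt_zero_right (mul_pos hpos h)
  · rwa [residencePolicy_trans_of_not hx hs] at h

variable {ν : ℝ} {R : Set S}

/-- The expected visits are the least nonnegative solution of the flow equations, obtained by
iterating them from zero; `x` is another solution with the same transition ratios. Equality can fail
when `x` contains a circulation. -/
theorem IsAbsorbingOn.sum_marginal_residencePolicy_le (h : M.IsAbsorbingOn R C)
    (hxf : x ∈ (residenceProgram πS C ν).feasible) (hfin : residenceDiv πS C x ≠ ⊤) (n : ℕ)
    (s : diffStates πS C) :
    ∑ t ∈ Finset.range n, (residencePolicy x hx).toPolicy.marginal t s ≤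
      residenceTotal πS C s x := by
  classical
  have hdom : (residencePolicy x hx).toPolicy.IsDominatedBy πS :=
    fun t s q _ hp => residencePolicy_trans_pos hx hfin hp
  induction n generalizing s with
  | zero => simpa using residenceTotal_nonneg hx s
  | succ n ih =>
    -- Time zero is split off because it matches the source term of the flow equation.
    rw [Finset.sum_range_succ', Policy.marginal_zero, (mem_residenceProgram_feasible.1 hxf).2.2 s]
    gcongr
    simp only [h.marginal_succ hdom _ s.2]
    rw [Finset.sum_comm, ← Finset.sum_coe_sort (diffStates πS C)]
    refine Finset.sum_le_sum fun q _ => ?_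
    rw [← residenceTotal_mul_trans hx]
    exact (Finset.sum_mul _ _ _).symm.trans_le
      (mul_le_mul_of_nonneg_right (ih q) ((residencePolicy x hx).trans_nonneg q s))

theorem IsAbsorbingOn.summable_marginal_residencePolicy (h : M.IsAbsorbingOn R C)
    (hxf : x ∈ (residenceProgram πS C ν).feasible) (hfin : residenceDiv πS C x ≠ ⊤)
    (s : diffStates πS C) :
    Summable fun t => (residencePolicy x hx).toPolicy.marginal t s :=
  summable_of_sum_range_le (fun t => Policy.marginal_nonneg _ t (s : S))
    fun n => h.sum_marginal_residencePolicy_le hx hxf hfin n s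

/-- Outside `diffStates` the policy copies the reference and pays nothing; inside, its cost per
visit is that of `x`, and it makes at most as many visits. -/
theorem IsAbsorbingOn.pathKL_residencePolicy_le (h : M.IsAbsorbingOn R C)
    (hxf : x ∈ (residenceProgram πS C ν).feasible) (hfin : residenceDiv πS C x ≠ ⊤) :
    pathKL (residencePolicy x hx).toPolicy πS ≤ residenceDiv πS C x := by
  have hs (s : diffStates πS C) := h.summable_marginal_residencePolicy hx hxf hfin s
  have hle (s : diffStates πS C) := (hs s).tsum_le_of_sum_range_le fun n =>
    h.sum_marginal_residencePolicy_le hx hxf hfin n s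
  have hdiv0 (s : S) (hs : s ∉ diffStates πS C) : (residencePolicy x hx).divAt πS s = 0 := by
    refine Finset.sum_eq_zero fun q _ => ?_
    rw [residencePolicy_trans_of_not hx fun h => hs h.1, relEnt_self (πS.trans_nonneg s q)]
  rw [residenceDiv_eq_sum_divAt hx]
  generalize residencePolicy x hx = π at *
  calc pathKL π.toPolicy πS
      = ∑' t, ∑ s, ENNReal.ofReal (π.toPolicy.marginal t s) * π.divAt πS s :=
        pathKL_eq_tsum π.toPolicy πS
    _ = ∑' t, ∑ s : diffStates πS C,
          ENNReal.ofReal (π.toPolicy.marginal t s) * π.divAt πS s := by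
        refine tsum_congr fun t => ?_
        rw [Finset.sum_coe_sort (diffStates πS C) fun s =>
          ENNReal.ofReal (π.toPolicy.marginal t s) * π.divAt πS s]
        exact (Finset.sum_subset (Finset.subset_univ _) fun s _ hs => by
          rw [hdiv0 s hs, mul_zero]).symm
    _ = ∑ s : diffStates πS C,
          (∑' t, ENNReal.ofReal (π.toPolicy.marginal t s)) * π.divAt πS s := by
        rw [Summable.tsum_finsetSum fun _ _ => ENNReal.summable]
        exact Finset.sum_congr rfl fun s _ => ENNReal.tsum_mul_right
    _ ≤ _ := by
        refine Finset.sum_le_sum fun s _ => ?_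
        gcongr
        rw [← ENNReal.ofReal_tsum_of_nonneg (fun t => Policy.marginal_nonneg _ t (s : S)) (hs s)]
        exact ENNReal.ofReal_le_ofReal (hle s)

theorem IsAbsorbingOn.le_reachProb_residencePolicy (h : M.IsAbsorbingOn R C)
    (hxf : x ∈ (residenceProgram πS C ν).feasible) (hfin : residenceDiv πS C x ≠ ⊤) :
    ν ≤ (residencePolicy x hx).toPolicy.reachProb C := by
  classical
  set π := residencePolicy x hx with hπ
  have hdom : π.toPolicy.IsDominatedBy πS := fun t s q _ hp => residencePolicy_trans_pos hx hfin hp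
  have hsum (s : S) (hs : s ∈ diffStates πS C) : Summable fun t => π.toPolicy.marginal t s :=
    h.summable_marginal_residencePolicy hx hxf hfin ⟨s, hs⟩
  obtain ⟨-, hreach, hflow⟩ := mem_residenceProgram_feasible.1 hxf
  let y (s : diffStates πS C) : ℝ := ∑' t, π.toPolicy.marginal t s
  -- The surplus of `x` over the true residence times solves the flow equations without source, so
  -- it is a circulation inside `diffStates`.
  let z (s : diffStates πS C) : ℝ := residenceTotal πS C s x - y s
  have hz0 (s : diffStates πS C) : 0 ≤ z s := sub_nonneg.2
    ((hsum s s.2).tsum_le_of_sum_range_le fun n =>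
      h.sum_marginal_residencePolicy_le hx hxf hfin n s)
  have hy (s : diffStates πS C) (q : S) :
      ∑' t, π.toPolicy.marginal t s * (π.toPolicy t).trans s q = y s * π.trans s q := by
    change ∑' t, π.toPolicy.marginal t s * π.trans s q = y s * π.trans s q
    exact tsum_mul_right
  have hzeq (s : diffStates πS C) : z s = ∑ q, z q * π.trans q s := by
    have h1 := h.tsum_marginal_eq hdom hsum s.2
    rw [← Finset.sum_coe_sort (diffStates πS C)] at h1
    simp only [hy] at h1
    simp only [z, sub_mul, Finset.sum_sub_distrib, hπ, residenceTotal_mul_trans]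
    rw [hflow s]
    change _ - ∑' t, π.toPolicy.marginal t s = _
    rw [h1]
    ring
  -- Summing the circulation equations over all states shows that the total outflow of `z` vanishes;
  -- in particular `z` sends nothing into `C`.
  have hzsum : ∑ s, z s * ∑ q with q ∉ diffStates πS C, π.trans s q = 0 := by
    have h1 (s : diffStates πS C) : z s * ∑ q with q ∉ diffStates πS C, π.trans s q =
        z s - ∑ q : diffStates πS C, z s * π.trans s q := by
      rw [← Finset.mul_sum, Finset.sum_coe_sort (diffStates πS C) fun q => π.trans s q]
      have h2 := Finset.sum_filter_add_sum_filter_not Finset.univ (· ∈ diffStates πS C)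
        fun q => π.trans s q
      rw [π.trans_sum, Finset.filter_univ_mem] at h2
      rw [← eq_sub_iff_add_eq'] at h2
      rw [h2]
      ring
    rw [Finset.sum_congr rfl fun s _ => h1 s, Finset.sum_sub_distrib, Finset.sum_comm,
      Finset.sum_congr rfl fun s _ => hzeq s, sub_self]
  have hzC (s : diffStates πS C) {q : S} (hq : q ∈ C) : z s * π.trans s q = 0 := by
    have h1 := (Finset.sum_eq_zero_iff_of_nonneg fun s _ => mul_nonneg (hz0 s)
      (Finset.sum_nonneg fun q _ => π.trans_nonneg s q)).1 hzsum s (Finset.mem_univ s)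
    rw [Finset.mul_sum] at h1
    exact (Finset.sum_eq_zero_iff_of_nonneg fun q _ => mul_nonneg (hz0 s)
      (π.trans_nonneg s q)).1 h1 q (by simp [mem_diffStates, hq])
  rw [h.reachProb_eq hdom hsum]
  refine hreach.trans (le_of_eq (Finset.sum_congr rfl fun q hq => ?_))
  have hqC : q ∈ C := (Finset.mem_filter.1 hq).2
  rw [← Finset.sum_coe_sort (diffStates πS C)]
  congr 1
  refine Finset.sum_congr rfl fun s _ => ?_
  rw [hy, ← residenceTotal_mul_trans hx, ← hπ]
  have h1 := hzC s hqC
  simp only [z, sub_mul] at h1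
  linarith

end ResidencePolicy

/-! ### Equivalence of the two problems -/

/-- One policy of finite divergence provides the starting point for compactness; every other such
policy has a feasible residence vector of no larger cost, so the minimum bounds the policy value
from below. -/
theorem IsAbsorbingOn.exists_optimal_residenceVar {R : Set S} (h : M.IsAbsorbingOn R C) {ν : ℝ}
    (hfin : deceptiveValue πS C ν < ⊤) :
    ∃ x ∈ (residenceProgram πS C ν).feasible, residenceDiv πS C x ≤ deceptiveValue πS C ν ∧
      ∀ y ∈ (residenceProgram πS C ν).feasible, residenceDiv πS C x ≤ residenceDiv πS C y := by
  simp only [deceptiveValue, iInf_lt_iff] at hfin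
  obtain ⟨π₀, hπ₀, hfin₀⟩ := hfin
  obtain ⟨x, hx, hmin⟩ := exists_isMinOn_residenceDiv
    (h.residenceVector_mem_feasible hfin₀.ne hπ₀)
    ((residenceDiv_residenceVector_le hfin₀.ne).trans_lt hfin₀).ne
  refine ⟨x, hx, le_iInf₂ fun π hπ => ?_, hmin⟩
  rcases eq_or_ne (pathKL π πS) ⊤ with htop | hfin
  · rw [htop]
    exact le_top
  · exact (hmin _ (h.residenceVector_mem_feasible hfin hπ)).trans
      (residenceDiv_residenceVector_le hfin)

theorem IsAbsorbingOn.deceptiveValue_le_residenceDiv {R : Set S} (h : M.IsAbsorbingOn R C) {ν : ℝ}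
    {x : ResidenceVar πS C} (hx : x ∈ (residenceProgram πS C ν).feasible) :
    deceptiveValue πS C ν ≤ residenceDiv πS C x := by
  rcases eq_or_ne (residenceDiv πS C x) ⊤ with htop | hfin
  · rw [htop]
    exact le_top
  · exact (iInf₂_le (residencePolicy x hx.1).toPolicy
      (h.le_reachProb_residencePolicy hx.1 hx hfin)).trans
        (h.pathKL_residencePolicy_le hx.1 hx hfin)

theorem IsAbsorbingOn.residenceProgram_value_eq {R : Set S} (h : M.IsAbsorbingOn R C) (ν : ℝ) :
    (residenceProgram πS C ν).value = ((deceptiveValue πS C ν : ℝ≥0∞) : EReal) := by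
  refine le_antisymm ?_ (le_iInf₂ fun x hx => ?_)
  · rcases eq_or_ne (deceptiveValue πS C ν) ⊤ with htop | hfin
    · rw [htop, EReal.coe_ennreal_top]
      exact le_top
    · obtain ⟨x, hx, hle, -⟩ := h.exists_optimal_residenceVar hfin.lt_top
      refine (iInf₂_le x hx).trans ?_
      rwa [residenceProgram_objective_eq hx.1, EReal.coe_ennreal_le_coe_ennreal_iff]
  · rw [residenceProgram_objective_eq hx.1, EReal.coe_ennreal_le_coe_ennreal_iff]
    exact h.deceptiveValue_le_residenceDiv hx

theorem IsAbsorbingOn.exists_optimal_stationaryPolicy {R : Set S} (h : M.IsAbsorbingOn R C) {ν : ℝ}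
    (hfin : deceptiveValue πS C ν < ⊤) :
    ∃ π : M.StationaryPolicy,
      (∀ s ∈ diffStates πS C, ∀ a ∈ M.avail s, π.toPolicy.residenceTime s a < ⊤) ∧
      residenceVector πS C π.toPolicy ∈ (residenceProgram πS C ν).feasible ∧
      (residenceProgram πS C ν).objective (residenceVector πS C π.toPolicy) =
        (residenceProgram πS C ν).value ∧
      π.toPolicy ∈ M.deceptiveFeasible C ν ∧
      pathKL π.toPolicy πS = deceptiveValue πS C ν := by
  obtain ⟨x, hx, hlow, hmin⟩ := h.exists_optimal_residenceVar hfin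
  have hxfin : residenceDiv πS C x ≠ ⊤ := (hlow.trans_lt hfin).ne
  let π := residencePolicy x hx.1
  have hπfeas : π.toPolicy ∈ M.deceptiveFeasible C ν :=
    h.le_reachProb_residencePolicy hx.1 hx hxfin
  have hπle : pathKL π.toPolicy πS ≤ residenceDiv πS C x :=
    h.pathKL_residencePolicy_le hx.1 hx hxfin
  have hπfin : pathKL π.toPolicy πS ≠ ⊤ := (hπle.trans_lt hxfin.lt_top).ne
  have hfeas := h.residenceVector_mem_feasible hπfin hπfeas
  have hπeq : pathKL π.toPolicy πS = deceptiveValue πS C ν :=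
    le_antisymm (hπle.trans hlow) (iInf₂_le _ hπfeas)
  refine ⟨π, fun s hs a _ => ?_, hfeas, ?_, hπfeas, hπeq⟩
  · exact Policy.residenceTime_lt_top
      (Policy.summable_marginal hπfin (mem_diffStates.1 hs).1) a
  · rw [h.residenceProgram_value_eq, residenceProgram_objective_eq hfeas.1,
      EReal.coe_ennreal_eq_coe_ennreal_iff]
    -- The residence vector of `π` may differ from the minimiser `x`, but its objective lies between
    -- the objective at `x` and the divergence of `π`, which coincide.
    exact le_antisymm ((residenceDiv_residenceVector_le hπfin).trans hπeq.le)
      (hπeq.ge.trans (hπle.trans (hmin _ hfeas)))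

end MDP

/-! ### Absorption of the target in the product with the automata -/

theorem productDFA_eval {α Q₁ Q₂ : Type*} (D₁ : DFA α Q₁) (D₂ : DFA α Q₂) (u : List α) :
    (productDFA D₁ D₂).eval u = (D₁.eval u, D₂.eval u) := by
  induction u using List.reverseRecOn with
  | nil => rfl
  | append_singleton u a ih =>
    rw [DFA.eval_append_singleton, DFA.eval_append_singleton, DFA.eval_append_singleton, ih]
    rfl

/-- In the product with automata, the states whose automaton component is reached by some word
contain the initial state and are closed under all moves, and acceptance of the second
specification is never lost on them. -/
theorem MDP.isAbsorbingOn_product {S A AP QS QA : Type*} [Fintype S] [Fintype QS] [Fintype QA]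
    (M : MDP S A AP) (DS : DFA (Set AP) QS) (DA : DFA (Set AP) QA)
    (hDA : ∀ u v : List (Set AP), u ∈ DA.accepts → u ++ v ∈ DA.accepts) :
    (M.product (productDFA DS DA)).IsAbsorbingOn {p | ∃ u, p.2 = (productDFA DS DA).eval u}
      {p | p.2.2 ∈ DA.accept} := by
  have hstep {p q : S × QS × QA} (hq : q ∈ (M.product (productDFA DS DA)).Succ p) :
      q.2 = (productDFA DS DA).step p.2 (M.label q.1) := by
    obtain ⟨a, -, ha⟩ := hq
    by_contra hne
    simp [MDP.product, hne] at ha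
  refine ⟨⟨[M.label M.init], ?_⟩, fun p ⟨u, hu⟩ q hq => ⟨u ++ [M.label q.1], ?_⟩,
    fun p ⟨u, hu⟩ hp q hq => ?_⟩
  · rw [DFA.eval_singleton]
    rfl
  · rw [hstep hq, hu, DFA.eval_append_singleton]
  · have h1 : q.2 = (productDFA DS DA).eval (u ++ [M.label q.1]) := by
      rw [hstep hq, hu, DFA.eval_append_singleton]
    rw [productDFA_eval] at hu h1
    have h2 : u ∈ DA.accepts := by
      rw [DFA.mem_accepts]
      have h3 : p.2.2 ∈ DA.accept := hp
      rwa [hu] at h3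
    -- Persistence of acceptance is known for words only, so it transfers to states through a word
    -- that reaches them; this is why absorption is claimed only on `R`.
    have h4 := (DFA.mem_accepts DA).1 (hDA u [M.label q.1] h2)
    change q.2.2 ∈ DA.accept
    rwa [h1]

theorem mainTheorem1
    {S A AP QS QA : Type*} [Fintype S] [Finite A] [Finite AP] [Fintype QS] [Fintype QA]
    [MeasurableSpace S] [MeasurableSingletonClass S]
    [MeasurableSpace QS] [MeasurableSingletonClass QS]
    [MeasurableSpace QA] [MeasurableSingletonClass QA]
    (M : MDP S A AP)
    (φS φA : LTL AP) (hφS : φS.IsCoSafe) (hφA : φA.IsCoSafe)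
    (DS : DFA (Set AP) QS) (DA : DFA (Set AP) QA)
    (hDS : φS.IsRepresentedBy DS) (hDA : φA.IsRepresentedBy DA)
    (πS : (M.product (productDFA DS DA)).StationaryPolicy)
    (ν : ℝ) (hν : ν ∈ Set.Icc (0 : ℝ) 1) :
    -- the set of product states that are accepting for the agent's specification
    let CA : Set (S × QS × QA) := {p | p.2.2 ∈ DA.accept}
    let P := MDP.residenceProgram πS CA ν
    P.IsConvex ∧
    P.value = ((MDP.deceptiveValue πS CA ν : ENNReal) : EReal) ∧
    (MDP.deceptiveValue πS CA ν < ⊤ →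
      ∃ π : (M.product (productDFA DS DA)).StationaryPolicy,
        (∀ s ∈ MDP.diffStates πS CA, ∀ a ∈ (M.product (productDFA DS DA)).avail s,
          π.toPolicy.residenceTime s a < ⊤) ∧
        MDP.residenceVector πS CA π.toPolicy ∈ P.feasible ∧
        P.objective (MDP.residenceVector πS CA π.toPolicy) = P.value ∧
        π.toPolicy ∈ (M.product (productDFA DS DA)).deceptiveFeasible CA ν ∧
        MDP.pathKL π.toPolicy πS = MDP.deceptiveValue πS CA ν) := by
  intro CA P
  have h := M.isAbsorbingOn_product DS DA hDA.2
  exact ⟨MDP.residenceProgram_isConvex ν, h.residenceProgram_value_eq ν,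
    h.exists_optimal_stationaryPolicy⟩
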